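/- **Lemma (space lower bound without regularity of $f$).** For $\varepsilon>0$ and $x\in[0,1]$ let $Q_x$ be the probability measure on $[0,1]$ with density $$K_\varepsilon(y,x)=C_\varepsilon(x)\,\frac{1}{\varepsilon\sqrt{2\pi}}\,e^{-(y-x)^2/2\varepsilon^2},\qquad C_\varepsilon(x)^{-1}=\int_0^1\frac{1}{\varepsilon\sqrt{2\pi}}\,e^{-(y-x)^2/2\varepsilon^2}\,dy .$$ An invariant measure of a map $f:[0,1]\to[0,1]$ with Gaussian noise $\varepsilon$ is a Borel probability measure $\mu$ on $[0,1]$ with $\mu(A)=\int Q_{f(x)}(A)\,d\mu(x)$ for all Borel sets $A$. Consider the following computational problem. An input is a binary word encoding: integers $m,n\ge 0$, which stand for the noise $\varepsilon=2^{-m}$ and the precision $\delta=2^{-n}$; an integer $0\le r\le m$, an arithmetic expression $e$ in variables $x_0,x_1,\dots$ (built from variables and natural-number constants by addition, truncated subtraction, multiplication, integer division, remainder, right shift, comparison and if-then-else), and a list of natural numbers $p_1,\dots,p_l$; and a dyadic interval $[a,b]=[i2^{-q},j2^{-q}]\subseteq[0,1]$. All numbers, including the exponents $m,n,r,q$, are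 written in binary, in a self-delimiting code. The input describes the (in general discontinuous) map $f$ that, with $N=2^r\le 1/\varepsilon$, sends the whole cell $[\frac kN,\frac{k+1}N)$ (the last one closed) to the point $\frac{2s(k)+1}{2N}$, where $s(k)$ is the value modulo $N$ of $e$ at $x_0=k$, $x_1=p_1,\dots,x_l=p_l$, all other variables being $0$. The task is to print a finite binary word $w_1w_2\dots w_t$ with $|0.w_1w_2\dots w_t-\mu([a,b])|\le\delta$, where $\mu$ is the invariant measure of $f$ with Gaussian noise $\varepsilon$. Let $T$ be any deterministic Turing machine, with a read-only two-way input tape, one read-write work tape and a one-way write-only output tape, that solves this problem on all inputs. Then $T$ requires space $\Omega\left(\log\frac1\varepsilon+\log\log\frac1\delta\right)$, even on short inputs. That is, there are constants $c>0$, $C$ and $k_0$, depending only on $T$, such that for all $m,n\ge k_0$ there is an input with noise $\varepsilon=2^{-m}$ and precision $\delta=2^{-n}$, of length at most $C\left(\log\frac1\varepsilon+\log\log\frac1\delta\right)$, on which $T$ visits at least $c\left(\log\frac1\varepsilon+\log\log\frac1\delta\right)$ cells of its work tape. -/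

import Mathlib

open MeasureTheory

namespace NoisySpace

/-! ### Noisy dynamical systems on `[0,1]` -/

noncomputable section

/-- The unnormalised Gaussian density with centre `x` and variance `ε ^ 2`. -/
def gaussDensity (ε x y : ℝ) : ℝ :=
  1 / (ε * Real.sqrt (2 * Real.pi)) * Real.exp (-(y - x) ^ 2 / (2 * ε ^ 2))

/-- The factor that makes the Gaussian density with centre `x` have mass one on `[0,1]`. -/
def gaussNorm (ε x : ℝ) : ℝ :=
  (∫ y in (0 : ℝ)..1, gaussDensity ε x y)⁻¹

/-- The Gaussian noise kernel `K_ε(y, x)` on `[0,1]`. -/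
def gaussKernel (ε y x : ℝ) : ℝ :=
  gaussNorm ε x * gaussDensity ε x y

/-- The noise measure `Q_x` on `[0,1]`, with density `y ↦ K_ε(y, x)`. -/
def noise (ε : ℝ) (x : unitInterval) : Measure unitInterval :=
  (volume : Measure unitInterval).withDensity fun y => ENNReal.ofReal (gaussKernel ε y x)

/-- `μ` is an invariant probability measure of the Markov chain that moves from `x` to a point
distributed according to `Q_{f(x)}`. -/
def IsInvariant (ε : ℝ) (f : unitInterval → unitInterval) (μ : Measure unitInterval) : Prop :=
  IsProbabilityMeasure μ ∧
    ∀ A : Set unitInterval, MeasurableSet A → μ A = ∫⁻ x, noise ε (f x) A ∂μ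

end

/-! ### Space-bounded Turing machines

Deterministic machines with a read-only two-way input tape, one read-write work tape
and a one-way write-only output tape. -/

/-- Head moves. -/
inductive Move : Type
  | left : Move
  | stay : Move
  | right : Move

/-- The new position of a head on a tape with leftmost cell `0`. -/
def Move.apply : Move → ℕ → ℕ
  | Move.left, i => i - 1
  | Move.stay, i => i
  | Move.right, i => i + 1

/-- What a machine does in one step; `output = some b` appends the bit `b` to the output. -/
structure Action (Q : Type) (S : Type) : Type where
  state : Q
  write : S
  workMove : Move
  inputMove : Move
  output : Option Bool

/-- A Turing machine. `next q i s` is the action in state `q` when the input head reads `i`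
(`none` is the end marker) and the work head reads `s`; the machine halts if it is `none`. -/
structure Machine : Type 1 where
  State : Type
  Sym : Type
  finiteState : Finite State
  finiteSym : Finite Sym
  start : State
  blank : Sym
  next : State → Option Bool → Sym → Option (Action State Sym)

/-- Configurations of a machine. -/
structure Config (M : Machine) : Type where
  state : M.State
  inputPos : ℕ
  tape : ℕ → M.Sym
  head : ℕ
  out : List Bool

/-- The input word stands in the cells `1, …, x.length`, with end markers in the cells `0` and
`x.length + 1`. -/
def inputSym (x : List Bool) (i : ℕ) : Option Bool :=
  if i = 0 then none else x[i - 1]?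

/-- The initial configuration. -/
def Machine.init (M : Machine) : Config M where
  state := M.start
  inputPos := 0
  tape := fun _ => M.blank
  head := 0
  out := []

/-- One step on input `x`; `none` if the machine has halted. -/
def Machine.step (M : Machine) (x : List Bool) (c : Config M) : Option (Config M) :=
  (M.next c.state (inputSym x c.inputPos) (c.tape c.head)).map fun a =>
    { state := a.state
      inputPos := min (a.inputMove.apply c.inputPos) (x.length + 1)
      tape := Function.update c.tape c.head a.write
      head := a.workMove.apply c.head
      out := c.out ++ a.output.toList }

/-- The configuration after `t` steps on input `x` (a halted machine stays as it is). -/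
def Machine.run (M : Machine) (x : List Bool) : ℕ → Config M
  | 0 => M.init
  | t + 1 => (M.step x (M.run x t)).getD (M.run x t)

/-- On input `x` the machine halts with `w` on its output tape. -/
def Machine.Outputs (M : Machine) (x w : List Bool) : Prop :=
  ∃ t, M.step x (M.run x t) = none ∧ (M.run x t).out = w

/-- On input `x` the machine visits at least `s` cells of its work tape. Only the work tape is
charged; the head starts in cell `0`, so having reached cell `h` means having visited `h + 1`
cells. -/
def Machine.UsesSpace (M : Machine) (x : List Bool) (s : ℝ) : Prop :=
  ∃ t, s ≤ ((M.run x t).head : ℝ) + 1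

/-! ### Finite descriptions of maps -/

/-- Operations on natural numbers: truncated subtraction, integer division, remainder,
`shr a b = ⌊a / 2 ^ b⌋`, and `lt a b`, which is `1` if `a < b` and `0` otherwise. -/
inductive Op : Type
  | add : Op
  | sub : Op
  | mul : Op
  | div : Op
  | mod : Op
  | shr : Op
  | lt : Op

def Op.eval : Op → ℕ → ℕ → ℕ
  | Op.add, a, b => a + b
  | Op.sub, a, b => a - b
  | Op.mul, a, b => a * b
  | Op.div, a, b => a / b
  | Op.mod, a, b => a % b
  | Op.shr, a, b => a / 2 ^ b
  | Op.lt, a, b => if a < b then 1 else 0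

def Op.code : Op → ℕ
  | Op.add => 0
  | Op.sub => 1
  | Op.mul => 2
  | Op.div => 3
  | Op.mod => 4
  | Op.shr => 5
  | Op.lt => 6

/-- Arithmetic expressions. -/
inductive Expr : Type
  | var : ℕ → Expr
  | num : ℕ → Expr
  | op : Op → Expr → Expr → Expr
  | ite : Expr → Expr → Expr → Expr

/-- The value of an expression; `ite c a b` is `a` if `c` is nonzero and `b` otherwise. -/
def Expr.eval (env : List ℕ) : Expr → ℕ
  | Expr.var i => env.getD i 0
  | Expr.num c => c
  | Expr.op o a b => o.eval (a.eval env) (b.eval env)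
  | Expr.ite c a b => if c.eval env = 0 then b.eval env else a.eval env

/-- Self-delimiting binary code of a natural number: every binary digit (least significant first)
is preceded by `true`, and `false` marks the end. -/
def encodeNat (k : ℕ) : List Bool :=
  k.bits.flatMap (fun b => [true, b]) ++ [false]

/-- Expressions are written in prefix notation. -/
def Expr.encode : Expr → List Bool
  | Expr.var i => encodeNat 0 ++ encodeNat i
  | Expr.num c => encodeNat 1 ++ encodeNat c
  | Expr.ite c a b => encodeNat 2 ++ c.encode ++ a.encode ++ b.encode
  | Expr.op o a b => encodeNat (3 + o.code) ++ a.encode ++ b.encode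

/-- The midpoint `(2 j + 1) / (2 N)` of the cell `[j / N, (j + 1) / N]`. -/
noncomputable def cellCentre (N j : ℕ) (h : j < N) : unitInterval :=
  ⟨(2 * (j : ℝ) + 1) / (2 * (N : ℝ)), by
    have h1 : (j : ℝ) + 1 ≤ N := by exact_mod_cast h
    have h2 : (0 : ℝ) ≤ j := Nat.cast_nonneg j
    constructor
    · positivity
    · rw [div_le_one (by linarith)]
      linarith⟩

/-- The index of the cell of `x` among the `N` cells `[k / N, (k + 1) / N)`, the last one closed. -/
noncomputable def cellIndex (N : ℕ) (x : unitInterval) : ℕ :=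
  min ⌊(x : ℝ) * N⌋₊ (N - 1)

/-! ### The computational problem -/

/-- An instance: noise `ε = 2 ^ (-m)`, precision `δ = 2 ^ (-n)`, a map that is constant on each of
`2 ^ r` equal cells, given by an expression for the index map, with the values of its parameters,
and the interval `[lo / 2 ^ q, hi / 2 ^ q]`. -/
structure Problem : Type where
  m : ℕ
  n : ℕ
  r : ℕ
  q : ℕ
  lo : ℕ
  hi : ℕ
  expr : Expr
  params : List ℕ

/-- The map has at most `1 / ε` cells and the interval is a subinterval of `[0,1]`. -/
def Problem.Valid (P : Problem) : Prop :=
  P.r ≤ P.m ∧ P.lo ≤ P.hi ∧ P.hi ≤ 2 ^ P.q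

/-- The input word. -/
def Problem.encode (P : Problem) : List Bool :=
  encodeNat P.m ++ encodeNat P.n ++ encodeNat P.r ++ encodeNat P.q ++ encodeNat P.lo ++
    encodeNat P.hi ++ P.expr.encode ++ encodeNat P.params.length ++ P.params.flatMap encodeNat

noncomputable section

/-- The size of the noise. -/
def Problem.eps (P : Problem) : ℝ := (1 / 2 : ℝ) ^ P.m

/-- The precision. -/
def Problem.delta (P : Problem) : ℝ := (1 / 2 : ℝ) ^ P.n

/-- The index map of the cells: variable `0` is the index of the cell, variable `i + 1` is the
`i`-th parameter. -/
def Problem.succ (P : Problem) (k : ℕ) : ℕ :=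
  P.expr.eval (k :: P.params) % 2 ^ P.r

/-- The map `f` that sends the `k`-th cell to the midpoint of cell number `succ k`. -/
def Problem.map (P : Problem) (x : unitInterval) : unitInterval :=
  cellCentre (2 ^ P.r) (P.succ (cellIndex (2 ^ P.r) x)) (Nat.mod_lt _ (by positivity))

/-- The interval whose weight is asked for. -/
def Problem.interval (P : Problem) : Set unitInterval :=
  {x | (P.lo : ℝ) / 2 ^ P.q ≤ (x : ℝ) ∧ (x : ℝ) ≤ (P.hi : ℝ) / 2 ^ P.q}

/-- The dyadic number `0.w₁w₂w₃…` in binary. -/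
def binaryFraction : List Bool → ℝ
  | [] => 0
  | b :: w => ((if b then 1 else 0) + binaryFraction w) / 2

/-- On the given instance the machine outputs the weight of the interval under the (unique)
invariant measure, with an error of at most `δ`. -/
def Machine.Solves (M : Machine) (P : Problem) : Prop :=
  ∃ w, M.Outputs P.encode w ∧ ∃ μ, IsInvariant P.eps P.map μ ∧
    |binaryFraction w - (μ P.interval).toReal| ≤ P.delta

end

end NoisySpace

/-!
The lower bound has two sources. With `g = ⌊log₂ n⌋`, the quantity
`log (1 / ε) + log (log (1 / δ))` is `m + g` up to constant factors (`log_add_log_log_bounds`), so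
it suffices to exhibit short inputs that need space proportional to `max m g`. Both times the
number of configurations matters: output aside, a machine that stays in `s` work cells has at most
`2 ^ O(s)` times a polynomial in the length of the input, and a halting computation repeats none of
them (`Machine.Outputs.exists_time`).

If `m < g`, a constant map is enough (`tinyProblem`). Its invariant measure is a noise measure
centred at distance `ε / 2` from `0`, and the interval `[0, 2 ^ (-(n - 2))]` has a weight that
exceeds `δ` but is at most `2 ^ m * 8 * δ`. An approximation within `δ` is therefore positive and
has at least `n - m - 4` binary digits, and a computation that prints them all needs as many
configurations (`Machine.Solves.le_numConfigs`).

If `g ≤ m`, the machine `M` is diagonalised against (`Machine.diagProblem`). There is one expression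
`M.simExpr` such that the map with this expression simulates `M`, restricted to space proportional
to `m`, on the very input that describes the map. For the self-reference, the parameters contain
the part of the input that precedes them, written as the binary digits of a number; the codes of
this number and of the length of that part are the rest of the input, and can be computed from
their values (`Expr.eval_inputCell`). A cell of `[0,1]` stands for a clock modulo `W = 2 ^ (m / 24)`
and a configuration of `M`. At time `0` the configuration is reset to the initial one; when `M`
prints its first bit or halts, the configuration moves to the half of `[0,1]` that contradicts this
bit as the leading binary digit of the weight of `[1/2,1]`, and remains there till the next reset.

There are so few cells that the noise leaves a cell only with a probability `η` far below
`1 / W ^ 2` (`noise_compl_cell_le`), whence every invariant measure is almost invariant under the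
index map of the cells (`IsInvariant.measure_cells_le`). Consequently the clock is almost uniformly
distributed, and, since each run of the clock starts with a reset, outside a set of measure about
`W ^ 2 * η` the configuration is the one that belongs to the time on the clock
(`clock_measure_le`). For most times this is the final one, so the weight of `[1/2,1]` is at most
`1/4` if the first output bit is `true`, and at least `3/4` otherwise, and the output is wrong
(`Machine.not_solves_diagProblem`).
-/

namespace NoisySpace

/-! ### The noise kernel -/

theorem continuous_gaussDensity (ε x : ℝ) : Continuous (gaussDensity ε x) := by
  unfold gaussDensity; fun_prop

theorem gaussDensity_pos {ε : ℝ} (hε : 0 < ε) (x y : ℝ) : 0 < gaussDensity ε x y := by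
  unfold gaussDensity; positivity

/-- The Gaussian density puts at least a constant weight on `[0,1]`: at distance at most `ε` from
the centre it is at least `exp (-1/2)` times its maximum, and `[0,1]` contains an interval of
length `ε` that starts or ends at the centre. -/
theorem le_integral_gaussDensity {ε : ℝ} (hε : 0 < ε) (hε' : ε ≤ 1 / 2) {x : ℝ} (h0 : 0 ≤ x)
    (h1 : x ≤ 1) :
    1 / (ε * √(2 * Real.pi)) * (ε * Real.exp (-1 / 2)) ≤ ∫ y in (0 : ℝ)..1, gaussDensity ε x y := by
  have key : ∀ a b : ℝ, 0 ≤ a → a ≤ b → b ≤ 1 → b - a = ε →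
      (∀ y ∈ Set.Icc a b, (y - x) ^ 2 ≤ ε ^ 2) →
      1 / (ε * √(2 * Real.pi)) * (ε * Real.exp (-1 / 2)) ≤
        ∫ y in (0 : ℝ)..1, gaussDensity ε x y := by
    intro a b ha hab hb hba hy
    have e1 : ∫ y in a..b, gaussDensity ε x y ≤ ∫ y in (0 : ℝ)..1, gaussDensity ε x y :=
      intervalIntegral.integral_mono_interval ha hab hb
        (Filter.Eventually.of_forall fun y => (gaussDensity_pos hε x y).le)
        ((continuous_gaussDensity ε x).intervalIntegrable _ _)
    refine le_trans ?_ e1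
    have e2 : ∫ _ in a..b, 1 / (ε * √(2 * Real.pi)) * Real.exp (-1 / 2) ≤
        ∫ y in a..b, gaussDensity ε x y := by
      refine intervalIntegral.integral_mono_on hab (by simp)
        ((continuous_gaussDensity ε x).intervalIntegrable _ _) fun y hyy => ?_
      unfold gaussDensity
      refine mul_le_mul_of_nonneg_left (Real.exp_le_exp.2 ?_) (by positivity)
      rw [div_le_div_iff₀ (by norm_num) (by positivity)]
      linarith [hy y hyy]
    rw [intervalIntegral.integral_const, hba, smul_eq_mul] at e2
    linarith
  rcases le_total x (1 / 2) with h | h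
  · refine key x (x + ε) h0 (by linarith) (by linarith) (by ring) fun y hy => ?_
    exact pow_le_pow_left₀ (by linarith [hy.1]) (by linarith [hy.2]) 2
  · refine key (x - ε) x (by linarith) (by linarith) h1 (by ring) fun y hy => ?_
    rw [← neg_sub, neg_sq]
    exact pow_le_pow_left₀ (by linarith [hy.2]) (by linarith [hy.1]) 2

theorem integral_gaussDensity_le {ε : ℝ} (hε : 0 < ε) (x : ℝ) :
    ∫ y in (0 : ℝ)..1, gaussDensity ε x y ≤ 1 / (ε * √(2 * Real.pi)) := by
  have : ∫ y in (0 : ℝ)..1, gaussDensity ε x y ≤ ∫ _ in (0 : ℝ)..1, 1 / (ε * √(2 * Real.pi)) := by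
    refine intervalIntegral.integral_mono_on zero_le_one
      ((continuous_gaussDensity ε x).intervalIntegrable _ _) (by simp) fun y _ => ?_
    unfold gaussDensity
    refine mul_le_of_le_one_right (by positivity) (Real.exp_le_one_iff.2 ?_)
    rw [neg_div]
    exact neg_nonpos.2 (by positivity)
  simpa using this

theorem integral_gaussDensity_pos {ε : ℝ} (hε : 0 < ε) (x : ℝ) :
    0 < ∫ y in (0 : ℝ)..1, gaussDensity ε x y :=
  intervalIntegral.intervalIntegral_pos_of_pos
    ((continuous_gaussDensity ε x).intervalIntegrable _ _) (gaussDensity_pos hε x) zero_lt_one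

theorem gaussKernel_le {ε : ℝ} (hε : 0 < ε) (hε' : ε ≤ 1 / 2) {x : ℝ} (h0 : 0 ≤ x)
    (h1 : x ≤ 1) (y : ℝ) :
    gaussKernel ε y x ≤ 2 / ε * Real.exp (-(y - x) ^ 2 / (2 * ε ^ 2)) := by
  have hI := integral_gaussDensity_pos hε x
  have hI' := le_integral_gaussDensity hε hε' h0 h1
  have he : 1 / 2 ≤ Real.exp (-1 / 2) := by
    have := Real.add_one_le_exp (-1 / 2 : ℝ)
    linarith
  unfold gaussKernel gaussNorm
  rw [inv_mul_le_iff₀ hI]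
  have hE := Real.exp_pos (-(y - x) ^ 2 / (2 * ε ^ 2))
  have hk : 0 < 1 / (ε * √(2 * Real.pi)) := by positivity
  unfold gaussDensity at hI' ⊢
  set E := Real.exp (-(y - x) ^ 2 / (2 * ε ^ 2))
  set κ := 1 / (ε * √(2 * Real.pi))
  calc κ * E = κ * (ε * (1 / 2)) * (2 / ε * E) := by field_simp
    _ ≤ κ * (ε * Real.exp (-1 / 2)) * (2 / ε * E) := by gcongr
    _ ≤ _ := by gcongr

theorem le_gaussKernel {ε : ℝ} (hε : 0 < ε) (x y : ℝ) :
    Real.exp (-(y - x) ^ 2 / (2 * ε ^ 2)) ≤ gaussKernel ε y x := by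
  have hI := integral_gaussDensity_pos hε x
  have hI' := integral_gaussDensity_le hε x
  unfold gaussKernel gaussNorm
  rw [le_inv_mul_iff₀ hI]
  unfold gaussDensity at hI' ⊢
  gcongr

theorem isProbabilityMeasure_noise {ε : ℝ} (hε : 0 < ε) (x : unitInterval) :
    IsProbabilityMeasure (noise ε x) := by
  have hI := integral_gaussDensity_pos hε x
  constructor
  unfold noise
  rw [withDensity_apply _ MeasurableSet.univ, Measure.restrict_univ]
  have := lintegral_subtype_comap (μ := volume)
    (measurableSet_Icc : MeasurableSet (Set.Icc (0 : ℝ) 1))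
    (fun y => ENNReal.ofReal (gaussKernel ε y x))
  refine this.trans ?_
  rw [← ofReal_integral_eq_lintegral_ofReal, integral_Icc_eq_integral_Ioc,
    ← intervalIntegral.integral_of_le zero_le_one]
  · unfold gaussKernel gaussNorm
    rw [intervalIntegral.integral_const_mul, inv_mul_cancel₀ hI.ne', ENNReal.ofReal_one]
  · unfold gaussKernel
    exact ((continuous_gaussDensity ε x).const_smul (gaussNorm ε x)).integrableOn_Icc
  · refine Filter.Eventually.of_forall fun y => ?_
    unfold gaussKernel gaussNorm
    have := gaussDensity_pos hε x y
    simp only [Pi.zero_apply]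
    positivity

theorem noise_le_of_gaussKernel_le {ε K : ℝ} {x : unitInterval} {A : Set unitInterval}
    (hA : MeasurableSet A) (h : ∀ y ∈ A, gaussKernel ε y x ≤ K) :
    noise ε x A ≤ ENNReal.ofReal K * volume A := by
  unfold noise
  rw [withDensity_apply _ hA, ← setLIntegral_const]
  exact setLIntegral_mono' hA fun y hy => ENNReal.ofReal_le_ofReal (h y hy)

theorem le_noise_of_le_gaussKernel {ε K : ℝ} {x : unitInterval} {A : Set unitInterval}
    (hA : MeasurableSet A) (h : ∀ y ∈ A, K ≤ gaussKernel ε y x) :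
    ENNReal.ofReal K * volume A ≤ noise ε x A := by
  unfold noise
  rw [withDensity_apply _ hA, ← setLIntegral_const]
  exact setLIntegral_mono' hA fun y hy => ENNReal.ofReal_le_ofReal (h y hy)

theorem measurable_cellIndex (N : ℕ) : Measurable (cellIndex N) := by
  unfold cellIndex
  exact (Nat.measurable_floor.comp (measurable_subtype_coe.mul_const _)).min measurable_const

/-- The set of points whose cell has its index in `S`. -/
def cells (N : ℕ) (S : Set ℕ) : Set unitInterval := cellIndex N ⁻¹' S

theorem measurableSet_cells (N : ℕ) (S : Set ℕ) : MeasurableSet (cells N S) :=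
  measurable_cellIndex N (MeasurableSet.of_discrete)

theorem cellIndex_eq_of_abs_lt {N j : ℕ} (h : j < N) {x : unitInterval}
    (hx : |(x : ℝ) - cellCentre N j h| < 1 / (2 * N)) : cellIndex N x = j := by
  have hN : (0 : ℝ) < N := by exact_mod_cast (by omega : 0 < N)
  rw [abs_lt] at hx
  simp only [cellCentre] at hx
  have e : (2 * (j : ℝ) + 1) / (2 * N) = (j + 1 / 2) / N := by field_simp
  have e' : 1 / (2 * (N : ℝ)) = (1 / 2) / N := by field_simp
  rw [e, e'] at hx
  have h1 : (j : ℝ) < x * N := by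
    rw [← div_lt_iff₀ hN]
    have : (j : ℝ) / N = (j + 1 / 2) / N - (1 / 2) / N := by ring
    linarith [hx.1]
  have h2 : (x : ℝ) * N < j + 1 := by
    rw [← lt_div_iff₀ hN]
    have : ((j : ℝ) + 1) / N = (j + 1 / 2) / N + (1 / 2) / N := by ring
    linarith [hx.2]
  have : ⌊(x : ℝ) * N⌋₊ = j := by
    rw [Nat.floor_eq_iff (mul_nonneg x.2.1 hN.le)]
    exact ⟨h1.le, h2⟩
  unfold cellIndex
  omega

/-- The noise rarely leaves a cell when started in its midpoint. -/
theorem noise_compl_cell_le {m r j : ℕ} (hm : 1 ≤ m) (h : j < 2 ^ r) :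
    noise ((1 / 2) ^ m) (cellCentre (2 ^ r) j h) (cells (2 ^ r) {j}ᶜ) ≤
      ENNReal.ofReal (16 * 2 ^ m * 4 ^ r / 4 ^ m) := by
  have hε : (0 : ℝ) < (1 / 2) ^ m := by positivity
  have hε' : ((1 : ℝ) / 2) ^ m ≤ 1 / 2 := pow_le_of_le_one (by norm_num) (by norm_num) (by omega)
  have := noise_le_of_gaussKernel_le (ε := (1 / 2) ^ m) (K := 16 * 2 ^ m * 4 ^ r / 4 ^ m)
    (x := cellCentre (2 ^ r) j h) (measurableSet_cells (2 ^ r) {j}ᶜ) fun y hy => by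
      refine (gaussKernel_le hε hε' (cellCentre _ j h).2.1 (cellCentre _ j h).2.2 _).trans ?_
      set c : ℝ := (cellCentre (2 ^ r) j h : ℝ)
      have hd : 1 / (2 * 2 ^ r) ≤ |(y : ℝ) - c| := by
        by_contra! hlt
        exact hy (cellIndex_eq_of_abs_lt h (by push_cast; exact hlt))
      have hd2 : (1 / (2 * 2 ^ r)) ^ 2 ≤ ((y : ℝ) - c) ^ 2 := by
        rw [← sq_abs ((y : ℝ) - c)]
        exact pow_le_pow_left₀ (by positivity) hd 2
      set z : ℝ := ((y : ℝ) - c) ^ 2 / (2 * ((1 / 2) ^ m) ^ 2) with hz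
      have hzl : (4 : ℝ) ^ m / 4 ^ r / 8 ≤ z := by
        rw [hz, le_div_iff₀ (by positivity)]
        refine le_trans (le_of_eq ?_) hd2
        have a1 : (4 : ℝ) ^ m = (2 ^ m) ^ 2 := by rw [← pow_mul, mul_comm, pow_mul]; norm_num
        have a2 : (4 : ℝ) ^ r = (2 ^ r) ^ 2 := by rw [← pow_mul, mul_comm, pow_mul]; norm_num
        rw [a1, a2, div_pow, one_pow]
        field_simp
        norm_num
      have hz0 : 0 < z := lt_of_lt_of_le (by positivity) hzl
      -- the tail is only needed up to a power of the noise, so `exp (-z) ≤ 1 / z` is enough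
      have hexp : Real.exp (-(y - c) ^ 2 / (2 * ((1 / 2) ^ m) ^ 2)) ≤ 8 * 4 ^ r / 4 ^ m := by
        rw [neg_div, ← hz, Real.exp_neg]
        have : z ≤ Real.exp z := by linarith [Real.add_one_le_exp z]
        calc (Real.exp z)⁻¹ ≤ ((4 : ℝ) ^ m / 4 ^ r / 8)⁻¹ := by
              gcongr
              linarith
          _ = 8 * 4 ^ r / 4 ^ m := by field_simp
      calc 2 / (1 / 2) ^ m * Real.exp (-(y - c) ^ 2 / (2 * ((1 / 2) ^ m) ^ 2))
          ≤ 2 / (1 / 2) ^ m * (8 * 4 ^ r / 4 ^ m) := by gcongr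
        _ = 16 * 2 ^ m * 4 ^ r / 4 ^ m := by
          rw [div_pow, one_pow]; field_simp; norm_num
  refine this.trans (mul_le_of_le_one_right zero_le prob_le_one)

/-! ### Invariant measures of maps between cells -/

/-- Up to the probability of leaving a cell, an invariant measure does not change when a union
of cells is pulled back along the index map. -/
theorem IsInvariant.measure_cells_le {P : Problem} (hm : 1 ≤ P.m) {μ : Measure unitInterval}
    (hμ : IsInvariant P.eps P.map μ) (S : Set ℕ) :
    μ (cells (2 ^ P.r) S) ≤ μ (cells (2 ^ P.r) (P.succ ⁻¹' S)) +
      ENNReal.ofReal (16 * 2 ^ P.m * 4 ^ P.r / 4 ^ P.m) := by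
  have := hμ.1
  set η := ENNReal.ofReal (16 * 2 ^ P.m * 4 ^ P.r / 4 ^ P.m)
  have hB := measurableSet_cells (2 ^ P.r) (P.succ ⁻¹' S)
  rw [hμ.2 _ (measurableSet_cells _ S)]
  have hε : 0 < P.eps := by unfold Problem.eps; positivity
  calc ∫⁻ x, noise P.eps (P.map x) (cells (2 ^ P.r) S) ∂μ
      ≤ ∫⁻ x, ((cells (2 ^ P.r) (P.succ ⁻¹' S)).indicator 1 x + η) ∂μ := by
        refine lintegral_mono fun x => ?_
        by_cases hx : x ∈ cells (2 ^ P.r) (P.succ ⁻¹' S)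
        · have := isProbabilityMeasure_noise hε (P.map x)
          rw [Set.indicator_of_mem hx]
          exact prob_le_one.trans le_self_add
        · rw [Set.indicator_of_notMem hx, zero_add]
          refine (measure_mono ?_).trans (noise_compl_cell_le hm (Nat.mod_lt _ (by positivity)))
          intro y hy hy'
          apply hx
          have : cellIndex (2 ^ P.r) y = P.succ (cellIndex (2 ^ P.r) x) := hy'
          simpa [cells, ← this] using hy
    _ = _ := by
        rw [lintegral_add_right _ measurable_const, lintegral_indicator_one hB]
        simp

theorem interval_eq_cells {P : Problem} (hr : 1 ≤ P.r) (hq : P.q = 1) (hlo : P.lo = 1)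
    (hhi : P.hi = 2) : P.interval = cells (2 ^ P.r) (Set.Ici (2 ^ (P.r - 1))) := by
  obtain ⟨r, hr'⟩ : ∃ r, P.r = r + 1 := ⟨P.r - 1, by omega⟩
  ext x
  have hx := x.2.2
  have hx0 := x.2.1
  have h2 : (2 : ℕ) ^ r ≤ 2 ^ (r + 1) - 1 := by
    have := Nat.one_le_two_pow (n := r)
    rw [pow_succ]; omega
  simp only [Problem.interval, hq, hlo, hhi, cells, cellIndex, hr', Set.mem_preimage, Set.mem_Ici,
    Set.mem_ofPred_eq, le_min_iff, Nat.add_sub_cancel, h2, and_true]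
  rw [Nat.le_floor_iff (by positivity)]
  have h3 : (0 : ℝ) < 2 ^ r := by positivity
  have e : (x : ℝ) * ((2 ^ (r + 1) : ℕ) : ℝ) = x * 2 * 2 ^ r := by push_cast; ring
  rw [e]
  push_cast
  norm_num
  constructor
  · rintro ⟨h, _⟩
    nlinarith
  · intro h
    refine ⟨?_, hx⟩
    by_contra! h'
    nlinarith

/-- A chain on `ℕ` with a clock `k % W`, that follows the map `s` up to an error `η`: if `s`
advances the clock, resets `k / W` to the value `c 1` at time `0`, and maps `c t` to `c (t + 1)`,
then outside a set of small measure `k / W` is `c (k % W)`. -/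
theorem clock_measure_le {ν : Measure ℕ} [IsProbabilityMeasure ν] {s c : ℕ → ℕ} {η : ℝ}
    (hη : 0 ≤ η) {W T : ℕ} (hν : ∀ S : Set ℕ, ν.real S ≤ ν.real (s ⁻¹' S) + η)
    (hs : ∀ k, s k % W = (k % W + 1) % W)
    (h0 : ∀ k, k % W = 0 → s k / W = c 1)
    (h1 : ∀ k t, 1 ≤ t → t + 1 < W → k % W = t → k / W = c t → s k / W = c (t + 1))
    (hT : 1 ≤ T) (hTW : T ≤ W) :
    ν.real {k | ¬ (T ≤ k % W ∧ k / W = c (k % W))} ≤ T / W + 3 * W ^ 2 * η := by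
  have hW : 0 < W := by omega
  have hWR : (0 : ℝ) < W := by exact_mod_cast hW
  -- the clock is almost uniformly distributed
  set a : ℕ → ℝ := fun x => ν.real {k | k % W = x % W} with ha
  have step : ∀ x, a (x + 1) ≤ a x + η := by
    intro x
    refine (hν _).trans (add_le_add_left (measureReal_mono ?_) _)
    intro k hk
    have hk' : s k % W = (x + 1) % W := hk
    rw [hs, Nat.mod_add_mod] at hk'
    exact Nat.ModEq.add_right_cancel' 1 hk'
  have steps : ∀ x j : ℕ, a (x + j) ≤ a x + j * η := by
    intro x j
    induction j with
    | zero => simp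
    | succ j ih =>
      have := step (x + j)
      rw [← add_assoc]
      push_cast
      linarith
  have hsum : ∑ x ∈ Finset.range W, a x = 1 := by
    have hU : (⋃ x ∈ Finset.range W, {k : ℕ | k % W = x % W}) = Set.univ := by
      ext k
      simp only [Set.mem_iUnion, Set.mem_ofPred_eq, Set.mem_univ, iff_true, Finset.mem_range]
      exact ⟨k % W, Nat.mod_lt _ hW, by simp⟩
    have := measureReal_biUnion_finset (μ := ν) (s := Finset.range W)
      (f := fun x => {k : ℕ | k % W = x % W}) (by
        intro x hx y hy hxy
        refine Set.disjoint_left.2 fun k hk hk' => hxy ?_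
        simp only [Finset.coe_range, Set.mem_Iio, Set.mem_ofPred_eq] at hx hy hk hk'
        rw [Nat.mod_eq_of_lt hx] at hk
        rw [Nat.mod_eq_of_lt hy] at hk'
        omega) (fun _ _ => MeasurableSet.of_discrete)
    rw [hU] at this
    simpa using this.symm
  have unif : ∀ x, x < W → a x ≤ 1 / W + 2 * W * η := by
    intro x hx
    have h : ∀ y ∈ Finset.range W, a x ≤ a y + 2 * W * η := by
      intro y hy
      have hy' := Finset.mem_range.1 hy
      have e := steps y (x + W - y)
      rw [show y + (x + W - y) = x + W by omega] at e
      have e1 : a (x + W) = a x := by simp [ha]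
      rw [e1] at e
      refine e.trans ?_
      gcongr
      exact_mod_cast (by omega : x + W - y ≤ 2 * W)
    have h' := Finset.sum_le_sum h
    rw [Finset.sum_add_distrib, hsum] at h'
    simp only [Finset.sum_const, Finset.card_range, nsmul_eq_mul] at h'
    have : a x * W ≤ (1 / W + 2 * W * η) * W := by
      have : (1 / W + 2 * W * η) * W = 1 + W * (2 * W * η) := by field_simp
      linarith
    exact le_of_mul_le_mul_right this hWR
  -- every error after the reset at time `0` is caused by the noise
  set b : ℕ → ℝ := fun t => ν.real {k | k % W = t ∧ k / W ≠ c t} with hb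
  have bstep : ∀ t, t + 1 < W → b (t + 1) ≤ (t + 1) * η := by
    intro t
    induction t with
    | zero =>
      intro ht
      refine (hν _).trans ?_
      have : s ⁻¹' {k | k % W = 0 + 1 ∧ k / W ≠ c (0 + 1)} = ∅ := by
        refine Set.eq_empty_of_forall_notMem fun k hk => ?_
        obtain ⟨hk1, hk2⟩ : s k % W = 0 + 1 ∧ s k / W ≠ c (0 + 1) := hk
        rw [hs] at hk1
        refine hk2 (h0 k ?_)
        have hlt := Nat.mod_lt k hW
        rcases (by omega : k % W + 1 < W ∨ k % W + 1 = W) with h | h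
        · rw [Nat.mod_eq_of_lt h] at hk1; omega
        · rw [h] at hk1; simp at hk1
      rw [this]
      simp
    | succ t ih =>
      intro ht
      have := ih (by omega)
      refine (hν _).trans ?_
      have hsub : s ⁻¹' {k | k % W = t + 1 + 1 ∧ k / W ≠ c (t + 1 + 1)} ⊆
          {k | k % W = t + 1 ∧ k / W ≠ c (t + 1)} := by
        intro k hk
        obtain ⟨hk1, hk2⟩ : s k % W = t + 1 + 1 ∧ s k / W ≠ c (t + 1 + 1) := hk
        rw [hs] at hk1
        have hlt := Nat.mod_lt k hW
        have hkt : k % W = t + 1 := by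
          rcases (by omega : k % W + 1 < W ∨ k % W + 1 = W) with h | h
          · rw [Nat.mod_eq_of_lt h] at hk1; omega
          · rw [h] at hk1; simp at hk1
        exact ⟨hkt, fun hc => hk2 (h1 k (t + 1) (by omega) ht hkt hc)⟩
      have := measureReal_mono (μ := ν) hsub
      push_cast
      simp only [hb] at ih
      linarith [ih (by omega)]
  have hcover : {k | ¬ (T ≤ k % W ∧ k / W = c (k % W))} ⊆
      (⋃ x ∈ Finset.range T, {k : ℕ | k % W = x % W}) ∪
        ⋃ x ∈ Finset.Ico T W, {k | k % W = x ∧ k / W ≠ c x} := by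
    intro k hk
    simp only [Set.mem_ofPred_eq, not_and_or, not_le] at hk
    simp only [Set.mem_union, Set.mem_iUnion, Finset.mem_range, Finset.mem_Ico, Set.mem_ofPred_eq]
    have hlt := Nat.mod_lt k hW
    by_cases h : k % W < T
    · exact Or.inl ⟨k % W, h, by simp⟩
    · exact Or.inr ⟨k % W, ⟨by omega, hlt⟩, rfl, by tauto⟩
  refine (measureReal_mono hcover).trans ((measureReal_union_le _ _).trans ?_)
  have e1 : ν.real (⋃ x ∈ Finset.range T, {k : ℕ | k % W = x % W}) ≤
      T * (1 / W + 2 * W * η) := by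
    refine (measureReal_biUnion_finset_le _ _).trans ?_
    refine (Finset.sum_le_card_nsmul _ _ (1 / W + 2 * W * η) fun x hx =>
      unif x ((Finset.mem_range.1 hx).trans_le hTW)).trans ?_
    rw [Finset.card_range, nsmul_eq_mul]
  have e2 : ν.real (⋃ x ∈ Finset.Ico T W, {k | k % W = x ∧ k / W ≠ c x}) ≤ W * (W * η) := by
    refine (measureReal_biUnion_finset_le _ _).trans ?_
    refine (Finset.sum_le_card_nsmul _ _ (W * η) fun x hx => ?_).trans ?_
    · obtain ⟨hx1, hx2⟩ := Finset.mem_Ico.1 hx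
      obtain ⟨t, rfl⟩ : ∃ t, x = t + 1 := ⟨x - 1, by omega⟩
      refine (bstep t hx2).trans ?_
      gcongr
      exact_mod_cast hx2.le
    · simp only [Nat.card_Ico, nsmul_eq_mul]
      gcongr
      exact_mod_cast Nat.sub_le W T
  have hTR : (T : ℝ) ≤ W := by exact_mod_cast hTW
  have e3 : (T : ℝ) * (1 / W + 2 * W * η) ≤ T / W + 2 * W ^ 2 * η := by
    have : (T : ℝ) * (2 * W * η) ≤ W * (2 * W * η) := by gcongr
    calc (T : ℝ) * (1 / W + 2 * W * η) = T / W + T * (2 * W * η) := by ring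
      _ ≤ T / W + W * (2 * W * η) := by linarith
      _ = _ := by ring
  calc _ ≤ (T / W + 2 * W ^ 2 * η) + W * (W * η) := add_le_add (e1.trans e3) e2
    _ = _ := by ring

theorem clock_error_le {m : ℕ} (hm : 24 ≤ m) :
    3 * (2 ^ (m / 24) : ℝ) ^ 2 * (16 * 2 ^ m * 4 ^ (5 * (m / 24) + 1) / 4 ^ m) ≤ 1 / 8 := by
  set w := m / 24
  have a1 : (4 : ℝ) ^ m = 2 ^ m * 2 ^ m := by rw [← mul_pow]; norm_num
  have a2 : (4 : ℝ) ^ (5 * w + 1) = 4 * 2 ^ (10 * w) := by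
    rw [pow_succ, show (4 : ℝ) = 2 ^ 2 by norm_num, ← pow_mul]; ring
  rw [a1, a2, mul_div_assoc', div_le_div_iff₀ (by positivity) (by norm_num)]
  have a3 : (2 : ℝ) ^ (12 * w + 11) ≤ 2 ^ m := pow_le_pow_right₀ (by norm_num) (by omega)
  have a4 : (2 : ℝ) ^ (12 * w + 11) = 2048 * ((2 ^ w) ^ 2 * 2 ^ (10 * w)) := by
    rw [← pow_mul, ← pow_add, pow_add _ _ 11, show w * 2 + 10 * w = 12 * w by ring]; ring
  calc 3 * ((2 : ℝ) ^ w) ^ 2 * (16 * 2 ^ m * (4 * 2 ^ (10 * w))) * 8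
      = 2 ^ m * (1536 * ((2 ^ w) ^ 2 * 2 ^ (10 * w))) := by ring
    _ ≤ 2 ^ m * (2048 * ((2 ^ w) ^ 2 * 2 ^ (10 * w))) := by gcongr; norm_num
    _ ≤ 2 ^ m * 2 ^ m := by rw [← a4]; gcongr
    _ = 1 * (2 ^ m * 2 ^ m) := by ring

/-- If the index map of a problem is driven by a clock, then the weight of `[1/2,1]` under an
invariant measure tells on which side of `1/2` the prescribed values `c t` lie for most times. -/
theorem IsInvariant.weight_of_clock {P : Problem} (hm : 24 ≤ P.m) (hr : P.r = 5 * (P.m / 24) + 1)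
    (hq : P.q = 1) (hlo : P.lo = 1) (hhi : P.hi = 2) {μ : Measure unitInterval}
    (hμ : IsInvariant P.eps P.map μ) {W T : ℕ} {c : ℕ → ℕ} (hW : W = 2 ^ (P.m / 24))
    (hs : ∀ k, P.succ k % W = (k % W + 1) % W)
    (h0 : ∀ k, k % W = 0 → P.succ k / W = c 1)
    (h1 : ∀ k t, 1 ≤ t → t + 1 < W → k % W = t → k / W = c t → P.succ k / W = c (t + 1))
    (hT : 1 ≤ T) (hTW : 8 * T ≤ W) :
    ((∀ t, T ≤ t → t < W → W ^ 4 ≤ c t) → 3 / 4 ≤ (μ P.interval).toReal) ∧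
    ((∀ t, T ≤ t → t < W → c t < W ^ 4) → (μ P.interval).toReal ≤ 1 / 4) := by
  have := hμ.1
  have hmeas := measurable_cellIndex (2 ^ P.r)
  have hνp : IsProbabilityMeasure (μ.map (cellIndex (2 ^ P.r))) :=
    Measure.isProbabilityMeasure_map hmeas.aemeasurable
  have hνS : ∀ S, (μ.map (cellIndex (2 ^ P.r))).real S = μ.real (cells (2 ^ P.r) S) := fun S => by
    rw [map_measureReal_apply hmeas MeasurableSet.of_discrete]; rfl
  set ν := μ.map (cellIndex (2 ^ P.r))
  set η : ℝ := 16 * 2 ^ P.m * 4 ^ P.r / 4 ^ P.m with hη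
  have hη0 : 0 ≤ η := by positivity
  have hν : ∀ S : Set ℕ, ν.real S ≤ ν.real (P.succ ⁻¹' S) + η := by
    intro S
    have := hμ.measure_cells_le (by omega) S
    rw [hνS, hνS]
    have h2 := ENNReal.toReal_mono (by finiteness) this
    rwa [ENNReal.toReal_add (by finiteness) (by finiteness), ENNReal.toReal_ofReal hη0] at h2
  have hWpos : 0 < W := by rw [hW]; positivity
  have hbad := clock_measure_le hη0 hν hs h0 h1 hT (by omega)
  have herr : 3 * (W : ℝ) ^ 2 * η ≤ 1 / 8 := by
    rw [hη, hr, hW]; push_cast; exact clock_error_le hm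
  have hTR : (T : ℝ) / W ≤ 1 / 8 := by
    rw [div_le_div_iff₀ (by exact_mod_cast hWpos) (by norm_num)]
    have : ((8 * T : ℕ) : ℝ) ≤ W := by exact_mod_cast hTW
    push_cast at this
    linarith
  have hI : (μ P.interval).toReal = ν.real (Set.Ici (W ^ 5)) := by
    rw [hνS, interval_eq_cells (by omega) hq hlo hhi, hr, hW, ← pow_mul,
      Nat.add_sub_cancel, mul_comm 5]
    rfl
  rw [hI]
  set B := {k | ¬ (T ≤ k % W ∧ k / W = c (k % W))} with hB
  have hdiv : ∀ k, W ^ 5 ≤ k ↔ W ^ 4 ≤ k / W := fun k => by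
    rw [Nat.le_div_iff_mul_le hWpos, ← pow_succ]
  constructor
  · intro h
    have hsub : (Set.Ici (W ^ 5))ᶜ ⊆ B := by
      intro k hk hk'
      simp only [Set.mem_compl_iff, Set.mem_Ici, hdiv] at hk
      exact hk (hk'.2 ▸ h _ hk'.1 (Nat.mod_lt _ hWpos))
    have h2 := measureReal_mono (μ := ν) hsub
    rw [probReal_compl_eq_one_sub MeasurableSet.of_discrete] at h2
    linarith
  · intro h
    have hsub : Set.Ici (W ^ 5) ⊆ B := by
      intro k hk hk'
      rw [Set.mem_Ici, hdiv] at hk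
      have := h _ hk'.1 (Nat.mod_lt _ hWpos)
      rw [← hk'.2] at this
      omega
    have h2 := measureReal_mono (μ := ν) hsub
    linarith

theorem IsInvariant.eq_noise_of_const {ε : ℝ} {f : unitInterval → unitInterval}
    {μ : Measure unitInterval} (hμ : IsInvariant ε f μ) {z : unitInterval} (hf : ∀ x, f x = z)
    {A : Set unitInterval} (hA : MeasurableSet A) : μ A = noise ε z A := by
  have := hμ.1
  rw [hμ.2 A hA]
  simp [hf]

/-- The problem that asks for the weight of `[0, 2 ^ (-q)]` under the noise measure whose centre
is at distance `ε / 2` from `0`. -/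
def tinyProblem (m n q : ℕ) : Problem where
  m := m
  n := n
  r := m
  q := q
  lo := 0
  hi := 1
  expr := Expr.num 0
  params := []

theorem tinyProblem_weight {m n q : ℕ} (hm : 1 ≤ m) (hq : m ≤ q) {μ : Measure unitInterval}
    (hμ : IsInvariant (tinyProblem m n q).eps (tinyProblem m n q).map μ) :
    (1 / 2) ^ q / 2 ≤ (μ (tinyProblem m n q).interval).toReal ∧
      (μ (tinyProblem m n q).interval).toReal ≤ 2 * 2 ^ m * (1 / 2) ^ q := by
  have := hμ.1
  set z := cellCentre (2 ^ m) 0 (by positivity) with hz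
  have hzv : (z : ℝ) = (1 / 2) ^ m / 2 := by
    rw [hz]
    simp only [cellCentre]
    push_cast
    rw [div_pow, one_pow]
    field_simp
    norm_num
  have hf : ∀ x, (tinyProblem m n q).map x = z := by
    intro x
    simp only [Problem.map, Problem.succ, tinyProblem, Expr.eval, Nat.zero_mod, hz]
  have hpq : ((1 : ℝ) / 2) ^ q ≤ (1 / 2) ^ m :=
    pow_le_pow_of_le_one (by norm_num) (by norm_num) hq
  have hpm : ((1 : ℝ) / 2) ^ m ≤ 1 / 2 := pow_le_of_le_one (by norm_num) (by norm_num) (by omega)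
  have hq0 : (0 : ℝ) < (1 / 2) ^ q := by positivity
  have hε : (0 : ℝ) < (1 / 2) ^ m := by positivity
  have hI : (tinyProblem m n q).interval =
      Set.Icc (0 : unitInterval) ⟨(1 / 2) ^ q, hq0.le, by linarith⟩ := by
    ext x
    simp only [Problem.interval, tinyProblem, Set.mem_ofPred_eq, Set.mem_Icc, ← Subtype.coe_le_coe]
    simp
  have hvol : volume (tinyProblem m n q).interval = ENNReal.ofReal ((1 / 2) ^ q) := by
    rw [hI, unitInterval.volume_Icc]; simp
  have hmeas : MeasurableSet (tinyProblem m n q).interval := by rw [hI]; exact measurableSet_Icc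
  rw [hμ.eq_noise_of_const hf hmeas]
  have heps : (tinyProblem m n q).eps = (1 / 2) ^ m := rfl
  rw [heps]
  have hprob := isProbabilityMeasure_noise hε z
  have hmem : ∀ y ∈ (tinyProblem m n q).interval, 0 ≤ (y : ℝ) ∧ (y : ℝ) ≤ (1 / 2) ^ q := by
    intro y hy
    rw [hI] at hy
    exact ⟨hy.1, hy.2⟩
  constructor
  · have h := le_noise_of_le_gaussKernel (ε := (1 / 2) ^ m) (x := z) (K := 1 / 2) hmeas
      fun y hy => by
        obtain ⟨y0, y1⟩ := hmem y hy
        refine le_trans ?_ (le_gaussKernel hε _ _)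
        have h1 : ((y : ℝ) - z) ^ 2 / (2 * ((1 / 2) ^ m) ^ 2) ≤ 1 / 8 := by
          rw [div_le_div_iff₀ (by positivity) (by norm_num), hzv]
          have : ((y : ℝ) - (1 / 2) ^ m / 2) ^ 2 ≤ ((1 / 2) ^ m / 2) ^ 2 :=
            sq_le_sq' (by linarith) (by linarith)
          nlinarith
        have h2 := Real.add_one_le_exp (-((y : ℝ) - z) ^ 2 / (2 * ((1 / 2) ^ m) ^ 2))
        rw [neg_div] at h2 ⊢
        linarith
    rw [hvol, ← ENNReal.ofReal_mul (by norm_num)] at h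
    have := ENNReal.toReal_mono (measure_ne_top _ _) h
    rw [ENNReal.toReal_ofReal (by positivity)] at this
    linarith
  · have h := noise_le_of_gaussKernel_le (ε := (1 / 2) ^ m) (x := z) (K := 2 * 2 ^ m) hmeas
      fun y hy => by
        refine (gaussKernel_le hε hpm z.2.1 z.2.2 y).trans ?_
        have : 2 / (1 / 2 : ℝ) ^ m = 2 * 2 ^ m := by rw [div_pow, one_pow]; field_simp
        rw [this]
        refine mul_le_of_le_one_right (by positivity) (Real.exp_le_one_iff.2 ?_)
        rw [neg_div]
        exact neg_nonpos.2 (by positivity)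
    rw [hvol, ← ENNReal.ofReal_mul (by positivity)] at h
    have := ENNReal.toReal_mono ENNReal.ofReal_ne_top h
    rwa [ENNReal.toReal_ofReal (by positivity)] at this

/-! ### Running times of space-bounded machines -/

/-- A configuration without the output tape, which has no influence on the computation. -/
def Config.core {M : Machine} (c : Config M) : M.State × ℕ × (ℕ → M.Sym) × ℕ :=
  (c.state, c.inputPos, c.tape, c.head)

namespace Machine

variable (M : Machine) (x : List Bool)

theorem run_succ_of_eq_some {t : ℕ} {c : Config M} (h : M.step x (M.run x t) = some c) :
    M.run x (t + 1) = c := by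
  simp [run, h]

theorem run_succ_of_eq_none {t : ℕ} (h : M.step x (M.run x t) = none) :
    M.run x (t + 1) = M.run x t := by
  simp [run, h]

theorem run_add_of_eq_none {t : ℕ} (h : M.step x (M.run x t) = none) (j : ℕ) :
    M.run x (t + j) = M.run x t := by
  induction j with
  | zero => rfl
  | succ j ih => rw [← add_assoc, run_succ_of_eq_none M x (by rw [ih, h]), ih]

theorem step_eq_none_of_core_eq {c c' : Config M} (h : c.core = c'.core)
    (hc : M.step x c = none) : M.step x c' = none := by
  simp only [Config.core, Prod.mk.injEq] at h
  obtain ⟨h1, h2, h3, h4⟩ := h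
  simpa [step, h1, h2, h3, h4] using hc

theorem core_run_succ_congr {t t' : ℕ} (h : (M.run x t).core = (M.run x t').core) :
    (M.run x (t + 1)).core = (M.run x (t' + 1)).core := by
  have h' := h
  simp only [Config.core, Prod.mk.injEq] at h
  obtain ⟨h1, h2, h3, h4⟩ := h
  simp only [run, step, h1, h2, h3, h4]
  cases M.next (M.run x t').state (inputSym x (M.run x t').inputPos)
    ((M.run x t').tape (M.run x t').head) with
  | none => simpa using h'
  | some a => simp [Config.core]

theorem run_succ_cases (t : ℕ) : M.run x (t + 1) = M.run x t ∨
    ∃ a : Action M.State M.Sym, M.run x (t + 1) =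
      { state := a.state
        inputPos := min (a.inputMove.apply (M.run x t).inputPos) (x.length + 1)
        tape := Function.update (M.run x t).tape (M.run x t).head a.write
        head := a.workMove.apply (M.run x t).head
        out := (M.run x t).out ++ a.output.toList } := by
  simp only [run, step]
  cases M.next (M.run x t).state (inputSym x (M.run x t).inputPos)
    ((M.run x t).tape (M.run x t).head) with
  | none => left; rfl
  | some a => right; exact ⟨a, rfl⟩

theorem inputPos_run_le (t : ℕ) : (M.run x t).inputPos ≤ x.length + 1 := by
  induction t with
  | zero => simp [run, init]
  | succ t ih =>
    rcases M.run_succ_cases x t with h | ⟨a, h⟩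
    · rwa [h]
    · rw [h]; exact min_le_right _ _

theorem tape_run_eq_blank {s : ℕ} (hs : ∀ t, (M.run x t).head < s) (t : ℕ) {j : ℕ} (hj : s ≤ j) :
    (M.run x t).tape j = M.blank := by
  induction t with
  | zero => rfl
  | succ t ih =>
    rcases M.run_succ_cases x t with h | ⟨a, h⟩
    · rwa [h]
    · rw [h]
      have : j ≠ (M.run x t).head := by have := hs t; omega
      simpa [Function.update_of_ne this] using ih

theorem out_run_prefix (t j : ℕ) : (M.run x t).out <+: (M.run x (t + j)).out := by
  induction j with
  | zero => exact List.prefix_refl _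
  | succ j ih =>
    refine ih.trans ?_
    rw [← add_assoc]
    rcases M.run_succ_cases x (t + j) with h | ⟨a, h⟩
    · rw [h]
    · rw [h]; exact List.prefix_append _ _

theorem length_out_run_le (t : ℕ) : (M.run x t).out.length ≤ t := by
  induction t with
  | zero => simp [run, init]
  | succ t ih =>
    rcases M.run_succ_cases x t with h | ⟨a, h⟩
    · rw [h]; omega
    · rw [h, List.length_append]
      have : a.output.toList.length ≤ 1 := by cases a.output <;> simp
      omega

/-- The number of configurations, output aside, with at most `s` work cells on an input of
length `l`. -/
noncomputable def numConfigs (s l : ℕ) : ℕ :=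
  Nat.card M.State * (l + 2) * s * Nat.card M.Sym ^ s

variable {M x}

/-- A halting computation does not repeat a configuration, so its length is bounded by the number
of configurations. -/
theorem Outputs.exists_time {w : List Bool} (hw : M.Outputs x w) {s : ℕ}
    (hs : ∀ t, (M.run x t).head < s) :
    ∃ T, T < M.numConfigs s x.length ∧ M.step x (M.run x T) = none ∧ (M.run x T).out = w := by
  classical
  have := M.finiteState
  have := M.finiteSym
  obtain ⟨t₀, ht₀, hout⟩ := hw
  have hex : ∃ t, M.step x (M.run x t) = none := ⟨t₀, ht₀⟩
  set T := Nat.find hex with hT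
  have hTn : M.step x (M.run x T) = none := Nat.find_spec hex
  have hTt : T ≤ t₀ := Nat.find_min' hex ht₀
  refine ⟨T, ?_, hTn, ?_⟩
  · let F : Fin (T + 1) → M.State × Fin (x.length + 2) × Fin s × (Fin s → M.Sym) := fun t =>
      ((M.run x t).state, ⟨(M.run x t).inputPos, by have := M.inputPos_run_le x t; omega⟩,
        ⟨(M.run x t).head, hs t⟩, fun j => (M.run x t).tape j)
    have core_eq : ∀ i j : Fin (T + 1), F i = F j → (M.run x i).core = (M.run x j).core := by
      intro i j hij
      simp only [F, Prod.mk.injEq, Fin.mk.injEq] at hij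
      obtain ⟨h1, h2, h3, h4⟩ := hij
      simp only [Config.core, Prod.mk.injEq]
      refine ⟨h1, h2, ?_, h3⟩
      funext k
      by_cases hk : k < s
      · exact congrFun h4 ⟨k, hk⟩
      · rw [M.tape_run_eq_blank x hs _ (by omega), M.tape_run_eq_blank x hs _ (by omega)]
    have not_lt : ∀ i j : Fin (T + 1), F i = F j → ¬ i < j := by
      intro i j hij hlt
      have h := core_eq i j hij
      -- a repeated configuration would make the machine halt before the first halting time
      have shift : ∀ k, (M.run x (i + k)).core = (M.run x (j + k)).core := by
        intro k
        induction k with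
        | zero => exact h
        | succ k ih => exact M.core_run_succ_congr x ih
      have hk := shift (T - j)
      have hj : (j : ℕ) ≤ T := by omega
      rw [Nat.add_sub_cancel' hj] at hk
      have hnone := M.step_eq_none_of_core_eq x hk.symm hTn
      have := Nat.find_min' hex hnone
      have : (i : ℕ) < j := hlt
      omega
    have hinj : Function.Injective F := by
      intro i j hij
      rcases lt_trichotomy i j with h | h | h
      · exact absurd h (not_lt i j hij)
      · exact h
      · exact absurd h (not_lt j i hij.symm)
    have hc := Nat.card_le_card_of_injective F hinj
    simp only [Nat.card_prod, Nat.card_fin, Nat.card_fun] at hc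
    rw [numConfigs]
    calc T < T + 1 := Nat.lt_succ_self _
      _ ≤ _ := hc
      _ = _ := by ring
  · obtain ⟨j, hj⟩ := Nat.exists_eq_add_of_le hTt
    rw [← hout, hj, M.run_add_of_eq_none x hTn]

/-- The time at which the first output bit is printed, or at which the machine halts without
output. -/
theorem Outputs.exists_first {w : List Bool} (hw : M.Outputs x w) {s : ℕ}
    (hs : ∀ t, (M.run x t).head < s) :
    ∃ T, T < M.numConfigs s x.length ∧ (∀ t ≤ T, (M.run x t).out = []) ∧
      (∀ t < T, M.step x (M.run x t) ≠ none) ∧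
      ((M.step x (M.run x T) = none ∧ w = []) ∨
        ∃ b w' c, M.step x (M.run x T) = some c ∧ c.out = [b] ∧ w = b :: w') := by
  classical
  obtain ⟨T₁, hT₁, hnone, hout⟩ := hw.exists_time hs
  have hex : ∃ t, M.step x (M.run x t) = none ∨ (M.run x (t + 1)).out ≠ [] := ⟨T₁, Or.inl hnone⟩
  set T := Nat.find hex with hT
  have hTT : T ≤ T₁ := Nat.find_min' hex (Or.inl hnone)
  have hlt : ∀ t < T, M.step x (M.run x t) ≠ none ∧ (M.run x (t + 1)).out = [] := by
    intro t ht
    have := Nat.find_min hex ht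
    push Not at this
    exact this
  have hempty : ∀ t ≤ T, (M.run x t).out = [] := by
    intro t ht
    cases t with
    | zero => rfl
    | succ t => exact (hlt t (by omega)).2
  refine ⟨T, by omega, hempty, fun t ht => (hlt t ht).1, ?_⟩
  have hspec : M.step x (M.run x T) = none ∨ (M.run x (T + 1)).out ≠ [] := Nat.find_spec hex
  cases hstep : M.step x (M.run x T) with
  | none =>
    left
    obtain ⟨j, hj⟩ := Nat.exists_eq_add_of_le hTT
    refine ⟨rfl, ?_⟩
    rw [← hout, hj, M.run_add_of_eq_none x hstep, hempty T le_rfl]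
  | some c =>
    right
    have hne : (M.run x (T + 1)).out ≠ [] := by
      rcases hspec with h | h
      · rw [hstep] at h; simp at h
      · exact h
    have hrun := M.run_succ_of_eq_some x hstep
    have hTlt : T < T₁ := by
      rcases hTT.lt_or_eq with h | h
      · exact h
      · rw [h, hnone] at hstep; simp at hstep
    have hc : ∃ b, c.out = [b] := by
      have h1 := M.length_out_run_le x (T + 1)
      simp only [step, Option.map_eq_some_iff] at hstep
      obtain ⟨a, -, ha⟩ := hstep
      rw [hrun] at hne
      have : c.out = a.output.toList := by rw [← ha, hempty T le_rfl, List.nil_append]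
      rw [this] at hne ⊢
      cases ho : a.output with
      | none => simp [ho] at hne
      | some b => exact ⟨b, rfl⟩
    obtain ⟨b, hb⟩ := hc
    obtain ⟨j, hj⟩ := Nat.exists_eq_add_of_le (show T + 1 ≤ T₁ from hTlt)
    have hpre := M.out_run_prefix x (T + 1) j
    rw [← hj, hout, hrun, hb] at hpre
    obtain ⟨w', hw'⟩ := hpre
    exact ⟨b, w', c, rfl, hb, hw'.symm⟩

end Machine

/-! ### Reading the code of a problem from numbers -/

/-- The contents of an input cell as a number. -/
def symCode : Option Bool → ℕ
  | none => 0
  | some false => 1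
  | some true => 2

theorem symCode_lt (o : Option Bool) : symCode o < 3 := by
  rcases o with _ | _ | _ <;> decide

theorem symCode_injective : Function.Injective symCode := by
  intro o o' h
  rcases o with _ | _ | _ <;> rcases o' with _ | _ | _ <;> simp_all [symCode]

/-- The contents of the `j`-th cell of the self-delimiting code of `x`, computed from `x`. -/
def encSym (x j : ℕ) : ℕ :=
  if j % 2 = 0 then if x / 2 ^ (j / 2) = 0 then 1 else 2
  else if x / 2 ^ (j / 2) = 0 then 0 else 1 + x / 2 ^ (j / 2) % 2

theorem length_encodeNat (x : ℕ) : (encodeNat x).length = 2 * x.size + 1 := by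
  have : ∀ l : List Bool, (l.flatMap (fun b => [true, b])).length = 2 * l.length := by
    intro l
    induction l with
    | nil => rfl
    | cons b l ih => simp [List.flatMap_cons, ih]; ring
  rw [encodeNat, List.length_append, this, Nat.size_eq_bits_len]
  rfl

theorem encodeNat_bit {b : Bool} {x : ℕ} (h : x = 0 → b = true) :
    encodeNat (Nat.bit b x) = true :: b :: encodeNat x := by
  simp [encodeNat, Nat.bits_append_bit x b h]

theorem symCode_encodeNat (x : ℕ) :
    ∀ j ≤ (encodeNat x).length, symCode (encodeNat x)[j]? = encSym x j := by
  induction x using Nat.binaryRec' with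
  | zero =>
    intro j hj
    have hj' : j ≤ 1 := by simpa [encodeNat] using hj
    interval_cases j <;> simp [encodeNat, encSym, symCode]
  | bit b x h ih =>
    intro j hj
    rw [encodeNat_bit h] at hj ⊢
    have hpos : Nat.bit b x ≠ 0 := by
      rw [Ne, Nat.bit_eq_zero_iff]
      rintro ⟨h1, h2⟩
      simp [h h1] at h2
    match j with
    | 0 => simp [encSym, symCode, hpos]
    | 1 => cases b <;> (simp [encSym, symCode, Nat.bit] at hpos ⊢; try omega)
    | j + 2 =>
      have := ih j (by simpa using hj)
      simp only [List.getElem?_cons_succ, this]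
      have hd : Nat.bit b x / 2 ^ ((j + 2) / 2) = x / 2 ^ (j / 2) := by
        rw [show (j + 2) / 2 = j / 2 + 1 by omega, pow_succ', ← Nat.div_div_eq_div_mul,
          Nat.bit_div_two]
      simp only [encSym, hd, Nat.add_mod_right]

/-- The number whose binary digits, least significant first, are the given word followed by a
leading one. -/
def ofBits (l : List Bool) : ℕ := l.foldr Nat.bit 1

theorem ofBits_ne_zero (l : List Bool) : ofBits l ≠ 0 := by
  induction l with
  | nil => simp [ofBits]
  | cons b l ih =>
    rw [ofBits, List.foldr_cons, Ne, Nat.bit_eq_zero_iff]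
    exact fun h => ih h.1

theorem bits_ofBits (l : List Bool) : (ofBits l).bits = l ++ [true] := by
  induction l with
  | nil => simp [ofBits]
  | cons b l ih =>
    have : ofBits (b :: l) = Nat.bit b (ofBits l) := rfl
    rw [this, Nat.bits_append_bit _ _ fun h => absurd h (ofBits_ne_zero l), ih, List.cons_append]

theorem symCode_ofBits (l : List Bool) :
    ∀ i < l.length, symCode l[i]? = 1 + ofBits l / 2 ^ i % 2 := by
  induction l with
  | nil => simp
  | cons b l ih =>
    intro i hi
    have hb : ofBits (b :: l) = Nat.bit b (ofBits l) := rfl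
    cases i with
    | zero => cases b <;> simp [hb, symCode]
    | succ i =>
      rw [List.getElem?_cons_succ, ih i (by simpa using hi), hb, pow_succ',
        ← Nat.div_div_eq_div_mul, Nat.bit_div_two]

/-! ### Building expressions -/

namespace Expr

instance : Add Expr := ⟨Expr.op Op.add⟩
instance : Sub Expr := ⟨Expr.op Op.sub⟩
instance : Mul Expr := ⟨Expr.op Op.mul⟩
instance : Div Expr := ⟨Expr.op Op.div⟩
instance : Mod Expr := ⟨Expr.op Op.mod⟩

variable (env : List ℕ) (a b c : Expr)

@[simp] theorem eval_add : (a + b).eval env = a.eval env + b.eval env := rfl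
@[simp] theorem eval_sub : (a - b).eval env = a.eval env - b.eval env := rfl
@[simp] theorem eval_mul : (a * b).eval env = a.eval env * b.eval env := rfl
@[simp] theorem eval_div : (a / b).eval env = a.eval env / b.eval env := rfl
@[simp] theorem eval_mod : (a % b).eval env = a.eval env % b.eval env := rfl
@[simp] theorem eval_shr : (op Op.shr a b).eval env = a.eval env / 2 ^ b.eval env := rfl
@[simp] theorem eval_lt :
    (op Op.lt a b).eval env = if a.eval env < b.eval env then 1 else 0 := rfl
@[simp] theorem eval_num (x : ℕ) : (num x).eval env = x := rfl
@[simp] theorem eval_ite :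
    (ite c a b).eval env = if c.eval env = 0 then b.eval env else a.eval env := rfl

/-- A finite table of the values of `F` on the numbers below `B`. -/
def table (F : ℕ → ℕ) : ℕ → Expr → Expr
  | 0, _ => num 0
  | B + 1, x => ite (op Op.lt x (num B)) (table F B x) (num (F B))

theorem eval_table (F : ℕ → ℕ) {B : ℕ} {x : Expr} (h : x.eval env < B) :
    (table F B x).eval env = F (x.eval env) := by
  induction B with
  | zero => omega
  | succ B ih =>
    by_cases hx : x.eval env < B
    · simp [table, hx, ih hx]
    · have : x.eval env = B := by omega
      simp [table, this]

/-- The contents of the cell with number `j` of the self-delimiting code of `x`. -/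
def encSym (x j : Expr) : Expr :=
  ite (j % num 2)
    (ite (op Op.shr x (j / num 2)) (num 1 + op Op.shr x (j / num 2) % num 2) (num 0))
    (ite (op Op.shr x (j / num 2)) (num 2) (num 1))

theorem eval_encSym (x j : Expr) :
    (encSym x j).eval env = NoisySpace.encSym (x.eval env) (j.eval env) := by
  simp only [encSym, NoisySpace.encSym, eval_ite, eval_mod, eval_num, eval_shr, eval_div, eval_add]
  rfl

/-- The contents of the input cell `i`, if the input consists of a word, the code of the number
`var 2` that contains this word in its binary digits, and the code of its length `var 3`. -/
def inputCell (i : Expr) : Expr :=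
  ite i
    (ite (op Op.lt (i - num 1) (var 3))
      (num 1 + op Op.shr (var 2) (i - num 1) % num 2)
      (ite (op Op.lt (i - num 1) (num 3 * var 3 + num 3))
        (encSym (var 2) (i - num 1 - var 3))
        (encSym (var 3) (i - num 1 - (num 3 * var 3 + num 3)))))
    (num 0)

/-- A word can be followed by numbers from which all the input, the code of these numbers
included, can be read. -/
theorem eval_inputCell {i : Expr} {k W : ℕ} {u x : List Bool}
    (hx : x = u ++ encodeNat (ofBits u) ++ encodeNat u.length)
    (hi : i.eval [k, W, ofBits u, u.length] ≤ x.length + 1) :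
    (inputCell i).eval [k, W, ofBits u, u.length] =
      symCode (inputSym x (i.eval [k, W, ofBits u, u.length])) := by
  set env := [k, W, ofBits u, u.length] with henv
  have e2 : (var 2).eval env = ofBits u := rfl
  have e3 : (var 3).eval env = u.length := rfl
  simp only [inputCell, eval_ite, eval_lt, eval_encSym, eval_add, eval_sub, eval_mul, eval_mod,
    eval_shr, eval_num, e2, e3]
  set i := i.eval env
  have hl : (encodeNat (ofBits u)).length = 2 * u.length + 3 := by
    rw [length_encodeNat, ← Nat.size_eq_bits_len, bits_ofBits, List.length_append]
    simp; ring
  by_cases hi0 : i = 0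
  · simp [hi0, inputSym, symCode]
  have hxl : x.length = u.length + (2 * u.length + 3) + (encodeNat u.length).length := by
    rw [hx, List.length_append, List.length_append, hl]
  simp only [hi0, if_false, inputSym]
  by_cases h1 : i - 1 < u.length
  · rw [if_pos h1, if_neg one_ne_zero, ← symCode_ofBits u _ h1, hx, List.append_assoc,
      List.getElem?_append_left h1]
  · rw [if_neg h1, if_pos rfl]
    by_cases h2 : i - 1 < 3 * u.length + 3
    · rw [if_pos h2, if_neg one_ne_zero, ← symCode_encodeNat _ _ (by omega), hx,
        List.getElem?_append_left (by rw [List.length_append, hl]; omega),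
        List.getElem?_append_right (by omega)]
    · rw [if_neg h2, if_pos rfl, ← symCode_encodeNat _ _ (by omega), hx,
        List.getElem?_append_right (by rw [List.length_append, hl]; omega),
        List.length_append, hl]
      congr 3
      omega

end Expr

/-! ### Tapes as numbers -/

/-- The number with the `s` digits `d 0, …, d (s - 1)` in base `A`. -/
def digitSum (A s : ℕ) (d : ℕ → ℕ) : ℕ := ∑ j ∈ Finset.range s, d j * A ^ j

theorem digitSum_lt {A : ℕ} {d : ℕ → ℕ} (hd : ∀ j, d j < A) (s : ℕ) : digitSum A s d < A ^ s := by
  induction s with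
  | zero => simp [digitSum]
  | succ s ih =>
    rw [digitSum, Finset.sum_range_succ, ← digitSum, pow_succ]
    have := Nat.mul_le_mul_right (A ^ s) (show d s + 1 ≤ A from hd s)
    nlinarith

theorem digitSum_div_mod {A : ℕ} {d : ℕ → ℕ} (hd : ∀ j, d j < A) {s h : ℕ} (hs : h < s) :
    digitSum A s d / A ^ h % A = d h := by
  have hA : 0 < A := (Nat.zero_le _).trans_lt (hd 0)
  induction s with
  | zero => omega
  | succ s ih =>
    rw [digitSum, Finset.sum_range_succ, ← digitSum]
    rcases (by omega : h < s ∨ h = s) with h' | rfl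
    · obtain ⟨j, rfl⟩ := Nat.exists_eq_add_of_le (show h + 1 ≤ s from h')
      rw [show d (h + 1 + j) * A ^ (h + 1 + j) = A ^ h * (A * (A ^ j * d (h + 1 + j))) by ring,
        Nat.add_mul_div_left _ _ (by positivity), Nat.add_mul_mod_self_left, ih h']
    · rw [Nat.add_mul_div_right _ _ (by positivity), Nat.div_eq_of_lt (digitSum_lt hd _), zero_add,
        Nat.mod_eq_of_lt (hd _)]

theorem digitSum_update (A : ℕ) (d : ℕ → ℕ) {s h : ℕ} (hs : h < s) (v : ℕ) :
    digitSum A s (Function.update d h v) = digitSum A s d + v * A ^ h - d h * A ^ h := by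
  have hmem := Finset.mem_range.2 hs
  have e1 := Finset.add_sum_erase (Finset.range s) (fun j => d j * A ^ j) hmem
  have e2 := Finset.add_sum_erase (Finset.range s)
    (fun j => Function.update d h v j * A ^ j) hmem
  have e3 : ∑ j ∈ (Finset.range s).erase h, Function.update d h v j * A ^ j =
      ∑ j ∈ (Finset.range s).erase h, d j * A ^ j := by
    refine Finset.sum_congr rfl fun j hj => ?_
    rw [Function.update_of_ne (Finset.ne_of_mem_erase hj)]
  simp only [Function.update_self] at e2
  rw [e3] at e2
  unfold digitSum
  omega

theorem eq_and_eq_of_add_mul_eq {A x x' y y' : ℕ} (hx : x < A) (hx' : x' < A)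
    (h : x + A * y = x' + A * y') : x = x' ∧ y = y' := by
  have h1 : x = x' := by
    have := congrArg (· % A) h
    simpa [Nat.add_mul_mod_self_left, Nat.mod_eq_of_lt hx, Nat.mod_eq_of_lt hx'] using this
  subst h1
  exact ⟨rfl, Nat.eq_of_mul_eq_mul_left (by omega) (Nat.add_left_cancel h)⟩

/-! ### Simulating a machine by an expression -/

namespace Machine

variable (M : Machine)

instance : Finite M.State := M.finiteState
instance : Finite M.Sym := M.finiteSym

/-- The number of a state. -/
noncomputable def stateNum (q : M.State) : ℕ :=
  Finite.equivFin M.State q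

theorem stateNum_lt (q : M.State) : M.stateNum q < Nat.card M.State := Fin.is_lt _

theorem stateNum_injective : Function.Injective M.stateNum :=
  Fin.val_injective.comp (Finite.equivFin M.State).injective

open Classical in
/-- The number of a tape symbol, which is `0` for the blank. -/
noncomputable def symNum (a : M.Sym) : ℕ :=
  if a = M.blank then 0 else Finite.equivFin M.Sym a + 1

/-- The number of binary digits reserved for a tape symbol. -/
noncomputable def symBits : ℕ := Nat.card M.Sym + 1

/-- The base in which tapes are written as numbers. -/
noncomputable def base : ℕ := 2 ^ M.symBits

theorem two_le_base : 2 ≤ M.base := by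
  unfold base symBits
  exact Nat.le_self_pow (by omega) 2

theorem card_sym_le_base : Nat.card M.Sym ≤ M.base :=
  (Nat.le_succ _).trans (Nat.lt_two_pow_self).le

theorem symNum_lt (a : M.Sym) : M.symNum a < M.base := by
  refine lt_of_le_of_lt ?_ (Nat.lt_two_pow_self (n := M.symBits))
  unfold symNum symBits
  split_ifs
  · omega
  · have := (Finite.equivFin M.Sym a).is_lt
    omega

theorem symNum_injective : Function.Injective M.symNum := by
  intro a b h
  unfold symNum at h
  split_ifs at h with h1 h2
  · rw [h1, h2]
  · exact (Finite.equivFin M.Sym).injective (Fin.val_injective (by omega))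

/-- The arguments of the transition function as one number. -/
noncomputable def key (z : M.State × Option Bool × M.Sym) : ℕ :=
  symCode z.2.1 + 3 * (M.symNum z.2.2 + M.base * M.stateNum z.1)

theorem key_injective : Function.Injective M.key := by
  rintro ⟨q, o, a⟩ ⟨q', o', a'⟩ h
  obtain ⟨h1, h2⟩ := eq_and_eq_of_add_mul_eq (symCode_lt o) (symCode_lt o') h
  obtain ⟨h3, h4⟩ := eq_and_eq_of_add_mul_eq (M.symNum_lt a) (M.symNum_lt a') h2
  simp only [Prod.mk.injEq]
  exact ⟨M.stateNum_injective h4, symCode_injective h1, M.symNum_injective h3⟩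

theorem key_lt (z : M.State × Option Bool × M.Sym) :
    M.key z < 3 * (M.base * Nat.card M.State) := by
  have h1 := symCode_lt z.2.1
  have h2 := M.symNum_lt z.2.2
  have h3 : M.base * (M.stateNum z.1 + 1) ≤ M.base * Nat.card M.State :=
    Nat.mul_le_mul_left _ (M.stateNum_lt z.1)
  unfold key
  rw [mul_add] at h3
  omega

/-- A table of some property `F` of the transitions of the machine. -/
noncomputable def tableExpr (F : Option (Action M.State M.Sym) → ℕ) (x : Expr) : Expr :=
  Expr.table (Function.extend M.key (fun z => F (M.next z.1 z.2.1 z.2.2)) 0)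
    (3 * (M.base * Nat.card M.State)) x

theorem eval_tableExpr {env : List ℕ} (F : Option (Action M.State M.Sym) → ℕ) {x : Expr}
    {q : M.State} {o : Option Bool} {a : M.Sym} (h : x.eval env = M.key (q, o, a)) :
    (M.tableExpr F x).eval env = F (M.next q o a) := by
  rw [tableExpr, Expr.eval_table _ _ (by rw [h]; exact M.key_lt _), h,
    M.key_injective.extend_apply]

/-- What is known after a transition: `0` if there is no output and the machine goes on, `2` if it
prints `true`, and `1` if it prints `false` or halts. -/
def outcome {Q S : Type} : Option (Action Q S) → ℕ
  | none => 1
  | some a =>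
    match a.output with
    | none => 0
    | some false => 1
    | some true => 2

/-- The number of a head move. -/
def moveNum : Move → ℕ
  | Move.stay => 0
  | Move.left => 1
  | Move.right => 2

/-- The number of a configuration: base `W` digits for the state, the position of the input head,
the power of `M.base` that belongs to the work cell under the head, and the first `s` work cells. -/
noncomputable def configNum (W s : ℕ) (c : Config M) : ℕ :=
  M.stateNum c.state + W * (c.inputPos + W * (M.base ^ c.head +
    W * digitSum M.base s fun j => M.symNum (c.tape j)))

/-- The number of the final configuration of the simulation, where `b` tells whether the first
output bit is `true`. The state `Nat.card M.State` stands for the end of the simulation. The numbers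
from `W ^ 4` on belong to cells in `[1/2,1]`, so that the wrong half is chosen. -/
noncomputable def finalNum (W : ℕ) (b : Bool) : ℕ :=
  if b then Nat.card M.State else Nat.card M.State + W * W * W * W

/-- One transition, from a configuration with the given four digits. -/
noncomputable def actionExpr (q i h d : Expr) : Expr :=
  let key := Expr.inputCell i +
    Expr.num 3 * (d / h % Expr.num M.base + Expr.num M.base * q)
  let f := fun F => M.tableExpr F key
  let inputMove := f fun a => a.elim 0 fun a => moveNum a.inputMove
  let workMove := f fun a => a.elim 0 fun a => moveNum a.workMove
  let W := Expr.var 1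
  Expr.ite (f outcome)
    (Expr.ite (f outcome - Expr.num 1)
      (Expr.num (Nat.card M.State))
      (Expr.num (Nat.card M.State) + W * W * W * W))
    (f (fun a => a.elim 0 fun a => M.stateNum a.state) +
      W * (Expr.ite inputMove
            (Expr.ite (inputMove - Expr.num 1)
              -- the head does not move beyond the right end marker
              (Expr.ite (Expr.inputCell i) (i + Expr.num 1) (Expr.ite i i (i + Expr.num 1)))
              (i - Expr.num 1))
            i +
        W * (Expr.ite workMove
              (Expr.ite (workMove - Expr.num 1)
                (h * Expr.num M.base)
                (Expr.ite (Expr.op Op.lt h (Expr.num M.base)) h (h / Expr.num M.base)))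
              h +
          W * (d + f (fun a => a.elim 0 fun a => M.symNum a.write) * h -
            d / h % Expr.num M.base * h))))

/-- One step of the simulation. -/
noncomputable def stepExpr (c : Expr) : Expr :=
  let W := Expr.var 1
  Expr.ite (Expr.op Op.lt (c % W) (Expr.num (Nat.card M.State)))
    (M.actionExpr (c % W) (c / W % W) (c / W / W % W) (c / W / W / W % W)) c

/-- The index map of the simulation: a clock modulo `W`, which starts the computation at time
`0`, and the number of a configuration. -/
noncomputable def simExpr : Expr :=
  let W := Expr.var 1
  (Expr.var 0 % W + Expr.num 1) % W +
    W * Expr.ite (Expr.var 0 % W) (M.stepExpr (Expr.var 0 / W))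
      (Expr.num (M.stateNum M.start) + W * W)

variable {M} {W k s : ℕ} {u x : List Bool}

/-- The bounds under which configurations fit into numbers with digits in base `W`. -/
structure Fits (M : Machine) (W s : ℕ) (x : List Bool) : Prop where
  card_lt : Nat.card M.State < W
  length_lt : x.length + 1 < W
  pow_le : M.base ^ s ≤ W

theorem Fits.pow_head_lt (hf : M.Fits W s x) {h : ℕ} (hh : h < s) : M.base ^ h < W :=
  lt_of_lt_of_le (Nat.pow_lt_pow_right M.two_le_base hh) hf.pow_le

/-- The action expression computes the transition of the machine. -/
theorem eval_actionExpr (hx : x = u ++ encodeNat (ofBits u) ++ encodeNat u.length)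
    {q i h d : Expr} {c : Config M}
    (hin : c.inputPos ≤ x.length + 1) (hh : c.head < s)
    (hq : q.eval [k, W, ofBits u, u.length] = M.stateNum c.state)
    (hi : i.eval [k, W, ofBits u, u.length] = c.inputPos)
    (hhe : h.eval [k, W, ofBits u, u.length] = M.base ^ c.head)
    (hd : d.eval [k, W, ofBits u, u.length] =
      digitSum M.base s fun j => M.symNum (c.tape j)) :
    (M.actionExpr q i h d).eval [k, W, ofBits u, u.length] =
      match M.step x c with
      | none => M.finalNum W false
      | some c' =>
        if outcome (M.next c.state (inputSym x c.inputPos) (c.tape c.head)) = 0 then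
          M.configNum W s c'
        else M.finalNum W (decide
          (outcome (M.next c.state (inputSym x c.inputPos) (c.tape c.head)) = 2)) := by
  set env := [k, W, ofBits u, u.length] with henv
  have hW : (Expr.var 1).eval env = W := rfl
  have hcell : (Expr.inputCell i).eval env = symCode (inputSym x c.inputPos) := by
    rw [Expr.eval_inputCell hx (by rw [← henv, hi]; exact hin), ← henv, hi]
  have hsym : digitSum M.base s (fun j => M.symNum (c.tape j)) / M.base ^ c.head % M.base =
      M.symNum (c.tape c.head) := digitSum_div_mod (fun j => M.symNum_lt _) hh
  have hkey : (Expr.inputCell i +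
      Expr.num 3 * (d / h % Expr.num M.base + Expr.num M.base * q)).eval env =
      M.key (c.state, inputSym x c.inputPos, c.tape c.head) := by
    simp only [Expr.eval_add, Expr.eval_mul, Expr.eval_div, Expr.eval_mod, Expr.eval_num, hcell,
      hd, hhe, hq, hsym, key]
  simp only [actionExpr, Expr.eval_add, Expr.eval_sub, Expr.eval_mul, Expr.eval_div, Expr.eval_mod,
    Expr.eval_num, Expr.eval_ite, Expr.eval_lt, M.eval_tableExpr _ hkey, hW, hcell, hd, hhe, hi,
    hsym]
  unfold step
  cases hn : M.next c.state (inputSym x c.inputPos) (c.tape c.head) with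
  | none => simp [outcome, finalNum]
  | some a =>
    simp only [Option.map_some, Option.elim_some]
    rcases ho : a.output with _ | _ | _
    · have h0 : outcome (some a) = 0 := by simp [outcome, ho]
      simp only [h0, if_true]
      -- the digits of the new configuration
      have e1 : (if moveNum a.inputMove = 0 then c.inputPos
          else if moveNum a.inputMove - 1 = 0 then c.inputPos - 1
          else if symCode (inputSym x c.inputPos) = 0 then
            if c.inputPos = 0 then c.inputPos + 1 else c.inputPos
          else c.inputPos + 1) = min (a.inputMove.apply c.inputPos) (x.length + 1) := by
        cases a.inputMove with
        | stay => simp [moveNum, Move.apply, hin]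
        | left => simp [moveNum, Move.apply]; omega
        | right =>
          simp only [moveNum, Move.apply]
          by_cases hp0 : c.inputPos = 0
          · simp [hp0]
          · by_cases hp1 : c.inputPos = x.length + 1
            · simp [inputSym, hp1, symCode]
            · have hlt : c.inputPos - 1 < x.length := by omega
              have : symCode (inputSym x c.inputPos) ≠ 0 := by
                simp only [inputSym, hp0, if_false, List.getElem?_eq_getElem hlt]
                cases x[c.inputPos - 1] <;> simp [symCode]
              simp [this]; omega
      have e2 : (if moveNum a.workMove = 0 then M.base ^ c.head
          else if moveNum a.workMove - 1 = 0 then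
            if (if M.base ^ c.head < M.base then 1 else 0) = 0 then M.base ^ c.head / M.base
            else M.base ^ c.head
          else M.base ^ c.head * M.base) = M.base ^ (a.workMove.apply c.head) := by
        have hb := M.two_le_base
        cases a.workMove with
        | stay => simp [moveNum, Move.apply]
        | right => simp [moveNum, Move.apply, pow_succ]
        | left =>
          simp only [moveNum, Move.apply]
          rcases hc : c.head with _ | j
          · simp [show 1 < M.base by omega]
          · have h1 : ¬ M.base ^ (j + 1) < M.base := by
              rw [not_lt]
              exact Nat.le_self_pow (by omega) _
            have h2 : M.base ^ (j + 1) / M.base = M.base ^ j := by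
              rw [pow_succ, Nat.mul_div_cancel _ (by omega)]
            simp [h1, h2]
      have e3 : (digitSum M.base s fun j => M.symNum (Function.update c.tape c.head a.write j)) =
          digitSum M.base s (fun j => M.symNum (c.tape j)) + M.symNum a.write * M.base ^ c.head -
            M.symNum (c.tape c.head) * M.base ^ c.head := by
        rw [← digitSum_update _ _ hh]
        congr 1
        funext j
        by_cases hj : j = c.head
        · subst hj; simp
        · simp [Function.update_of_ne hj]
      rw [configNum, e3, ← e1, ← e2]
      rfl
    · simp [outcome, ho, finalNum]
    · simp [outcome, ho, finalNum]

/-- The lowest digit in base `W`, and the number that consists of the other digits. -/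
theorem add_mul_div_mod {W a b : ℕ} (ha : a < W) : (a + W * b) / W = b ∧ (a + W * b) % W = a := by
  constructor
  · rw [Nat.add_mul_div_left _ _ (by omega), Nat.div_eq_of_lt ha, zero_add]
  · rw [Nat.add_mul_mod_self_left, Nat.mod_eq_of_lt ha]

theorem eval_stepExpr_of_config (hf : M.Fits W s x)
    (hx : x = u ++ encodeNat (ofBits u) ++ encodeNat u.length) {e : Expr} {c : Config M}
    (hin : c.inputPos ≤ x.length + 1) (hh : c.head < s)
    (he : e.eval [k, W, ofBits u, u.length] = M.configNum W s c) :
    (M.stepExpr e).eval [k, W, ofBits u, u.length] =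
      match M.step x c with
      | none => M.finalNum W false
      | some c' =>
        if outcome (M.next c.state (inputSym x c.inputPos) (c.tape c.head)) = 0 then
          M.configNum W s c'
        else M.finalNum W (decide
          (outcome (M.next c.state (inputSym x c.inputPos) (c.tape c.head)) = 2)) := by
  set env := [k, W, ofBits u, u.length] with henv
  have hW : (Expr.var 1).eval env = W := rfl
  have b1 : M.stateNum c.state < W := (M.stateNum_lt _).trans hf.card_lt
  have b2 : c.inputPos < W := lt_of_le_of_lt hin hf.length_lt
  have b3 : M.base ^ c.head < W := hf.pow_head_lt hh
  have b4 : (digitSum M.base s fun j => M.symNum (c.tape j)) < W :=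
    (digitSum_lt (fun j => M.symNum_lt _) s).trans_le hf.pow_le
  unfold configNum at he
  have m1 := (add_mul_div_mod (b := c.inputPos + W * (M.base ^ c.head +
    W * digitSum M.base s fun j => M.symNum (c.tape j))) b1)
  have m2 := (add_mul_div_mod (b := M.base ^ c.head +
    W * digitSum M.base s fun j => M.symNum (c.tape j)) b2)
  have m3 := (add_mul_div_mod (b := digitSum M.base s fun j => M.symNum (c.tape j)) b3)
  have := eval_actionExpr (k := k) hx (c := c) hin hh
    (q := e % Expr.var 1) (i := e / Expr.var 1 % Expr.var 1)
    (h := e / Expr.var 1 / Expr.var 1 % Expr.var 1)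
    (d := e / Expr.var 1 / Expr.var 1 / Expr.var 1 % Expr.var 1)
    (by rw [← henv, Expr.eval_mod, hW, he, m1.2])
    (by rw [← henv, Expr.eval_mod, Expr.eval_div, hW, he, m1.1, m2.2])
    (by rw [← henv, Expr.eval_mod, Expr.eval_div, Expr.eval_div, hW, he, m1.1, m2.1, m3.2])
    (by rw [← henv, Expr.eval_mod, Expr.eval_div, Expr.eval_div, Expr.eval_div, hW, he, m1.1,
          m2.1, m3.1, Nat.mod_eq_of_lt b4])
  rw [← this]
  simp only [stepExpr, Expr.eval_ite, Expr.eval_lt, Expr.eval_mod, Expr.eval_num, hW, he, m1.2,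
    M.stateNum_lt, if_true, one_ne_zero, if_false, ← henv]

theorem eval_stepExpr_of_final (hW : Nat.card M.State < W) {p l : ℕ} {e : Expr} {b : Bool}
    (he : e.eval [k, W, p, l] = M.finalNum W b) :
    (M.stepExpr e).eval [k, W, p, l] = M.finalNum W b := by
  have hv : (Expr.var 1).eval [k, W, p, l] = W := rfl
  have : M.finalNum W b % W = Nat.card M.State := by
    unfold finalNum
    split_ifs
    · exact Nat.mod_eq_of_lt hW
    · rw [mul_assoc, mul_assoc, Nat.add_mul_mod_self_left, Nat.mod_eq_of_lt hW]
  simp only [stepExpr, Expr.eval_ite, Expr.eval_lt, Expr.eval_mod, Expr.eval_num, hv, he, this,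
    lt_irrefl, if_false, if_true]

theorem configNum_lt (hf : M.Fits W s x) {c : Config M} (hin : c.inputPos ≤ x.length + 1)
    (hh : c.head < s) : M.configNum W s c < W ^ 4 := by
  have b1 : M.stateNum c.state < W := (M.stateNum_lt _).trans hf.card_lt
  have b2 : c.inputPos < W := lt_of_le_of_lt hin hf.length_lt
  have b3 : M.base ^ c.head < W := hf.pow_head_lt hh
  have b4 : (digitSum M.base s fun j => M.symNum (c.tape j)) < W :=
    (digitSum_lt (fun j => M.symNum_lt _) s).trans_le hf.pow_le
  have key : ∀ {a b X : ℕ}, a < W → b < X → a + W * b < W * X := by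
    intro a b X ha hb
    calc a + W * b < W + W * b := by omega
      _ = W * (b + 1) := by ring
      _ ≤ W * X := Nat.mul_le_mul_left _ hb
  unfold configNum
  rw [show W ^ 4 = W * (W * (W * W)) by ring]
  exact key b1 (key b2 (key b3 b4))

theorem configNum_init (W s : ℕ) : M.configNum W s M.init = M.stateNum M.start + W * W := by
  simp [configNum, init, digitSum, symNum]

end Machine

/-! ### The two hard families of instances -/

theorem binaryFraction_nonneg (w : List Bool) : 0 ≤ binaryFraction w := by
  induction w with
  | nil => exact le_rfl
  | cons b w ih => cases b <;> simp [binaryFraction] <;> linarith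

theorem binaryFraction_le_one (w : List Bool) : binaryFraction w ≤ 1 := by
  induction w with
  | nil => exact zero_le_one
  | cons b w ih => cases b <;> simp [binaryFraction] <;> linarith

theorem le_binaryFraction_of_pos {w : List Bool} (h : 0 < binaryFraction w) :
    (1 / 2) ^ w.length ≤ binaryFraction w := by
  induction w with
  | nil => simp [binaryFraction] at h
  | cons b w ih =>
    have hp : ((1 : ℝ) / 2) ^ w.length ≤ 1 := pow_le_one₀ (by norm_num) (by norm_num)
    have h0 := binaryFraction_nonneg w
    rw [List.length_cons, pow_succ]
    cases b
    · simp only [binaryFraction, Bool.false_eq_true, if_false, zero_add] at h ⊢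
      have := ih (by linarith)
      linarith
    · simp only [binaryFraction, if_true] at h ⊢
      linarith

namespace Machine

variable {M : Machine}

/-- The weight of an interval of length about `δ` is tiny but larger than `δ`, so that almost `n`
bits have to be printed; this takes more than `n - m - 4` configurations. -/
theorem Solves.le_numConfigs {m n s : ℕ} (hm : 1 ≤ m) (hmn : m + 2 ≤ n)
    (h : M.Solves (tinyProblem m n (n - 2)))
    (hs : ∀ t, (M.run (tinyProblem m n (n - 2)).encode t).head < s) :
    n ≤ M.numConfigs s (tinyProblem m n (n - 2)).encode.length + m + 4 := by
  obtain ⟨w, hw, μ, hμ, hd⟩ := h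
  obtain ⟨T, hT, -, hout⟩ := hw.exists_time hs
  have hlen : w.length ≤ T := by rw [← hout]; exact M.length_out_run_le _ _
  obtain ⟨h1, h2⟩ := tinyProblem_weight (n := n) hm (show m ≤ n - 2 by omega) hμ
  have hδ : (tinyProblem m n (n - 2)).delta = (1 / 2) ^ n := rfl
  rw [hδ, abs_le] at hd
  have hn : ((1 : ℝ) / 2) ^ (n - 2) = 4 * (1 / 2) ^ n := by
    obtain ⟨j, rfl⟩ := Nat.exists_eq_add_of_le' (show 2 ≤ n by omega)
    rw [Nat.add_sub_cancel, pow_add]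
    ring
  rw [hn] at h1 h2
  have hp : (0 : ℝ) < (1 / 2) ^ n := by positivity
  have hl := le_binaryFraction_of_pos (w := w) (by linarith)
  have hm1 : (1 : ℝ) ≤ 2 ^ m := one_le_pow₀ (by norm_num)
  have hup : ((1 : ℝ) / 2) ^ w.length ≤ 2 ^ (m + 4) * (1 / 2) ^ n := by
    have : (2 : ℝ) ^ (m + 4) = 16 * 2 ^ m := by rw [pow_add]; norm_num; ring
    rw [this]
    nlinarith
  have hup' : (2 : ℝ) ^ n ≤ 2 ^ (m + 4 + w.length) := by
    rw [div_pow, div_pow, one_pow, one_pow, mul_one_div,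
      div_le_div_iff₀ (by positivity) (by positivity), one_mul, ← pow_add] at hup
    exact hup
  have := (pow_le_pow_iff_right₀ (by norm_num : (1 : ℝ) < 2)).1 hup'
  omega

variable (M)

/-- The part of the code of the diagonal problem that comes before its two last parameters. -/
noncomputable def diagPrefix (m n : ℕ) : List Bool :=
  encodeNat m ++ encodeNat n ++ encodeNat (5 * (m / 24) + 1) ++ encodeNat 1 ++ encodeNat 1 ++
    encodeNat 2 ++ M.simExpr.encode ++ encodeNat 3 ++ encodeNat (2 ^ (m / 24))

/-- The problem whose map simulates the machine on the code of this same problem. -/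
noncomputable def diagProblem (m n : ℕ) : Problem where
  m := m
  n := n
  r := 5 * (m / 24) + 1
  q := 1
  lo := 1
  hi := 2
  expr := M.simExpr
  params := [2 ^ (m / 24), ofBits (M.diagPrefix m n), (M.diagPrefix m n).length]

theorem encode_diagProblem (m n : ℕ) : (M.diagProblem m n).encode =
    M.diagPrefix m n ++ encodeNat (ofBits (M.diagPrefix m n)) ++
      encodeNat (M.diagPrefix m n).length := by
  simp [Problem.encode, diagProblem, diagPrefix, List.append_assoc]

variable {M}

theorem outcome_next {x : List Bool} {c c' : Config M} (hc : c.out = [])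
    (h : M.step x c = some c') :
    (c'.out = [] → outcome (M.next c.state (inputSym x c.inputPos) (c.tape c.head)) = 0) ∧
      ∀ b, c'.out = [b] → outcome (M.next c.state (inputSym x c.inputPos) (c.tape c.head)) =
        if b then 2 else 1 := by
  simp only [step, Option.map_eq_some_iff] at h
  obtain ⟨a, ha, rfl⟩ := h
  rw [ha]
  rcases ho : a.output with _ | _ | _ <;> simp [hc, ho, outcome]

theorem finalNum_lt {W : ℕ} (hW : Nat.card M.State < W) (b : Bool) :
    M.finalNum W b < 2 * W ^ 4 := by
  have : W ≤ W ^ 4 := Nat.le_self_pow (by norm_num) W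
  have e : W * W * W * W = W ^ 4 := by ring
  unfold finalNum
  split_ifs <;> omega

/-- The machine does not solve the diagonal problem in small space: the map of this problem moves
a set of measure at least `3/4` into `[1/2,1]` or away from it, contrary to the first output bit
of the machine. -/
theorem not_solves_diagProblem {m n s : ℕ} (hm : 24 ≤ m) (hn : 3 ≤ n)
    (hs : ∀ t, (M.run (M.diagProblem m n).encode t).head < s)
    (hf : M.Fits (2 ^ (m / 24)) s (M.diagProblem m n).encode)
    (hW : 8 * (M.numConfigs s (M.diagProblem m n).encode.length + 2) ≤ 2 ^ (m / 24)) :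
    ¬ M.Solves (M.diagProblem m n) := by
  rintro ⟨w, hw, μ, hμ, hd⟩
  obtain ⟨T, hT, hempty, hgo, hend⟩ := hw.exists_first hs
  have hx := M.encode_diagProblem m n
  set x := (M.diagProblem m n).encode with hxdef
  set u := M.diagPrefix m n
  set W := 2 ^ (m / 24) with hWdef
  have hWpos : 0 < W := by positivity
  have hin := M.inputPos_run_le x
  -- the answer of the machine, as far as it matters
  obtain ⟨b, hb, hwb⟩ : ∃ b : Bool,
      (∀ (k : ℕ) (e : Expr), e.eval [k, W, ofBits u, u.length] = M.configNum W s (M.run x T) →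
        (M.stepExpr e).eval [k, W, ofBits u, u.length] = M.finalNum W b) ∧
      (if b then 1 / 2 ≤ binaryFraction w else binaryFraction w ≤ 1 / 2) := by
    rcases hend with ⟨hnone, rfl⟩ | ⟨b, w', c, hsome, hcb, rfl⟩
    · refine ⟨false, fun k e he => ?_, by norm_num [binaryFraction]⟩
      rw [eval_stepExpr_of_config hf hx (hin T) (hs T) he, hnone]
    · refine ⟨b, fun k e he => ?_, ?_⟩
      · have ho := (outcome_next (hempty T le_rfl) hsome).2 b hcb
        rw [eval_stepExpr_of_config hf hx (hin T) (hs T) he, hsome]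
        simp only [ho]
        cases b <;> simp
      · have h0 := binaryFraction_nonneg w'
        have h1 := binaryFraction_le_one w'
        cases b <;> simp [binaryFraction] <;> linarith
  have hstep : ∀ (k : ℕ) (e : Expr), ∀ t < T,
      e.eval [k, W, ofBits u, u.length] = M.configNum W s (M.run x t) →
        (M.stepExpr e).eval [k, W, ofBits u, u.length] = M.configNum W s (M.run x (t + 1)) := by
    intro k e t ht he
    obtain ⟨c, hc⟩ := Option.ne_none_iff_exists'.1 (hgo t ht)
    have hrun := M.run_succ_of_eq_some x hc
    have ho := (outcome_next (hempty t ht.le) hc).1 (by rw [← hrun]; exact hempty _ ht)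
    rw [eval_stepExpr_of_config hf hx (hin t) (hs t) he, hc, hrun]
    simp only [ho, if_true]
  -- the numbers of the configurations at the times shown by the clock
  let c : ℕ → ℕ := fun t =>
    if t ≤ T + 1 then M.configNum W s (M.run x (t - 1)) else M.finalNum W b
  have hc : ∀ t, c t < 2 * W ^ 4 := by
    intro t
    simp only [c]
    split_ifs
    · have := configNum_lt hf (hin (t - 1)) (hs (t - 1))
      omega
    · exact finalNum_lt hf.card_lt b
  have hsucc : ∀ k, (M.diagProblem m n).succ k = ((k % W + 1) % W + W *
      if k % W = 0 then M.configNum W s M.init else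
        (M.stepExpr (Expr.var 0 / Expr.var 1)).eval [k, W, ofBits u, u.length]) %
          (W * (2 * W ^ 4)) := by
    intro k
    rw [configNum_init, show W * (2 * W ^ 4) = 2 ^ (5 * (m / 24) + 1) by
      rw [hWdef]; ring]
    rfl
  have hmod : ∀ k, (k % W + 1) % W < W := fun k => Nat.mod_lt _ hWpos
  have hweight := hμ.weight_of_clock hm rfl rfl rfl rfl (W := W) (T := T + 2) (c := c) hWdef
    (by
      intro k
      rw [hsucc, Nat.mod_mul_right_mod, (add_mul_div_mod (hmod k)).2])
    (by
      intro k hk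
      rw [hsucc, Nat.mod_mul_right_div_self, (add_mul_div_mod (hmod k)).1, if_pos hk]
      exact Nat.mod_eq_of_lt (hc 1))
    (by
      intro k t h1 ht hk hkc
      rw [hsucc, Nat.mod_mul_right_div_self, (add_mul_div_mod (hmod k)).1, if_neg (by omega)]
      have he : (Expr.var 0 / Expr.var 1).eval [k, W, ofBits u, u.length] = k / W := rfl
      suffices (M.stepExpr (Expr.var 0 / Expr.var 1)).eval [k, W, ofBits u, u.length] =
          c (t + 1) by
        rw [this, Nat.mod_eq_of_lt (hc _)]
      rw [hkc] at he
      obtain ⟨j, rfl⟩ := Nat.exists_eq_add_of_le' h1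
      simp only [c, Nat.add_sub_cancel] at he ⊢
      rcases lt_trichotomy j T with h | h | h
      · rw [if_pos (by omega)] at he ⊢
        exact hstep k _ j h he
      · rw [if_pos (by omega), h] at he
        rw [if_neg (by omega)]
        exact hb k _ he
      · rw [if_neg (by omega)] at he ⊢
        exact eval_stepExpr_of_final hf.card_lt he)
    (by omega) (by omega)
  have hcT : ∀ t, T + 2 ≤ t → c t = M.finalNum W b := fun t ht => if_neg (by omega)
  have hδ : (M.diagProblem m n).delta ≤ 1 / 8 := by
    have : ((1 : ℝ) / 2) ^ n ≤ (1 / 2) ^ 3 :=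
      pow_le_pow_of_le_one (by norm_num) (by norm_num) hn
    calc (M.diagProblem m n).delta = (1 / 2) ^ n := rfl
      _ ≤ 1 / 8 := by norm_num at this ⊢; exact this
  rw [abs_le] at hd
  cases b
  · have := hweight.1 fun t ht _ => by
      rw [hcT t ht]
      have e : W * W * W * W = W ^ 4 := by ring
      simp [finalNum, e]
    simp at hwb
    linarith [hd.1]
  · have := hweight.2 fun t ht _ => by
      rw [hcT t ht]
      have : W ≤ W ^ 4 := Nat.le_self_pow (by norm_num) W
      have := hf.card_lt
      simp only [finalNum, if_true]
      omega
    simp at hwb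
    linarith [hd.2]

/-! ### Sizes -/

theorem length_encode_tinyProblem_le {m n u : ℕ} (hmu : m ≤ u) (hn : n < 2 ^ (u + 1))
    (hu : 1 ≤ u) : (tinyProblem m n (n - 2)).encode.length ≤ 32 * u := by
  have h1 : m.size ≤ u := Nat.size_le.2 (hmu.trans_lt Nat.lt_two_pow_self)
  have h2 : n.size ≤ u + 1 := Nat.size_le.2 hn
  have h3 : (n - 2).size ≤ u + 1 := Nat.size_le.2 ((Nat.sub_le _ _).trans_lt hn)
  simp only [Problem.encode, tinyProblem, Expr.encode, List.length_append, length_encodeNat,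
    List.length_nil, List.flatMap_nil, Nat.size_zero, Nat.size_one]
  omega

theorem length_encode_diagProblem_le {m n : ℕ} (hm : 24 ≤ m) (hn : n < 2 ^ (m + 1)) :
    (M.diagProblem m n).encode.length ≤ 9 * (40 + M.simExpr.encode.length) * m := by
  have h1 : m.size ≤ m := Nat.size_le.2 Nat.lt_two_pow_self
  have h2 : n.size ≤ m + 1 := Nat.size_le.2 hn
  have h3 : (5 * (m / 24) + 1).size ≤ m :=
    Nat.size_le.2 (lt_of_le_of_lt (by omega) Nat.lt_two_pow_self)
  have h4 : (2 ^ (m / 24)).size ≤ m :=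
    Nat.size_le.2 (Nat.pow_lt_pow_right (by norm_num) (by omega))
  have h5 : (2 : ℕ).size ≤ 2 := Nat.size_le.2 (by norm_num)
  have h6 : (3 : ℕ).size ≤ 2 := Nat.size_le.2 (by norm_num)
  have hl : (M.diagPrefix m n).length ≤ (39 + M.simExpr.encode.length) * m := by
    have : M.simExpr.encode.length ≤ M.simExpr.encode.length * m :=
      Nat.le_mul_of_pos_right _ (by omega)
    simp only [diagPrefix, List.length_append, length_encodeNat, Nat.size_one]
    rw [add_mul]
    omega
  have h7 : (M.diagPrefix m n).length.size ≤ (M.diagPrefix m n).length :=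
    Nat.size_le.2 Nat.lt_two_pow_self
  have h8 : (ofBits (M.diagPrefix m n)).size = (M.diagPrefix m n).length + 1 := by
    rw [← Nat.size_eq_bits_len, bits_ofBits]; simp
  rw [encode_diagProblem, List.length_append, List.length_append, length_encodeNat,
    length_encodeNat, h8]
  have e1 : 9 * (40 + M.simExpr.encode.length) * m =
      9 * ((39 + M.simExpr.encode.length) * m) + 9 * m := by ring
  omega

theorem numConfigs_le {s l C u : ℕ} (hs : s = u / (48 * M.symBits)) (hl : l ≤ C * u)
    (hu : 1 ≤ u) :
    M.numConfigs s l ≤ Nat.card M.State * (C + 2) * u ^ 2 * 2 ^ (u / 48) ∧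
      M.base ^ s ≤ 2 ^ (u / 48) := by
  have h1 : M.base ^ s ≤ 2 ^ (u / 48) := by
    rw [base, ← pow_mul, hs, ← Nat.div_div_eq_div_mul]
    exact Nat.pow_le_pow_right (by norm_num) (Nat.mul_div_le _ _)
  refine ⟨?_, h1⟩
  have h2 : Nat.card M.Sym ^ s ≤ 2 ^ (u / 48) :=
    (Nat.pow_le_pow_left M.card_sym_le_base s).trans h1
  have h3 : s ≤ u := hs ▸ Nat.div_le_self _ _
  have h4 : l + 2 ≤ (C + 2) * u := by rw [add_mul]; omega
  calc M.numConfigs s l ≤ Nat.card M.State * ((C + 2) * u) * u * 2 ^ (u / 48) := by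
        unfold numConfigs; gcongr
    _ = _ := by ring

/-- For large `u`, space below `u / (48 * M.symBits)` leaves so few configurations that the length
of a computation and its configurations fit into numbers with `u / 24` digits. -/
theorem configs_fit {s C u : ℕ} (hs : s = u / (48 * M.symBits)) (hu : 2 ≤ u)
    (hgrow : 32 * (Nat.card M.State + 1) * (C + 3) * u ^ 2 ≤ 2 ^ (u / 48)) :
    (∀ l ≤ C * u, 8 * (M.numConfigs s l + 2) ≤ 2 ^ (u / 24)) ∧ M.base ^ s ≤ 2 ^ (u / 24) ∧
      Nat.card M.State + C * u + 2 ≤ 2 ^ (u / 24) := by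
  obtain ⟨Q, hQ⟩ : ∃ Q, Q = Nat.card M.State := ⟨_, rfl⟩
  rw [← hQ] at hgrow ⊢
  have h3 : 2 ^ (u / 48) * 2 ^ (u / 48) ≤ 2 ^ (u / 24) := by
    rw [← pow_add]
    exact Nat.pow_le_pow_right (by norm_num) (by omega)
  have h4 : 1 ≤ 2 ^ (u / 48) := Nat.one_le_two_pow
  have h6 : 2 ^ (u / 48) ≤ 2 ^ (u / 24) := le_trans (Nat.le_mul_of_pos_right _ h4) h3
  refine ⟨fun l hl => ?_, (numConfigs_le hs (l := 0) (C := 0) (by omega) (by omega)).2.trans h6, ?_⟩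
  · have h1 := (numConfigs_le hs hl (by omega)).1
    rw [← hQ] at h1
    have h5 : 2 ≤ u ^ 2 * 2 ^ (u / 48) := by nlinarith
    calc 8 * (M.numConfigs s l + 2)
        ≤ 8 * (Q * (C + 2) * u ^ 2 * 2 ^ (u / 48) + u ^ 2 * 2 ^ (u / 48)) := by gcongr
      _ = (8 * (Q * (C + 2) + 1) * u ^ 2) * 2 ^ (u / 48) := by ring
      _ ≤ (32 * (Q + 1) * (C + 3) * u ^ 2) * 2 ^ (u / 48) := by
          refine Nat.mul_le_mul_right _ (Nat.mul_le_mul_right _ ?_)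
          nlinarith
      _ ≤ 2 ^ (u / 48) * 2 ^ (u / 48) := Nat.mul_le_mul_right _ hgrow
      _ ≤ _ := h3
  · refine le_trans ?_ (hgrow.trans h6)
    have h7 : 32 * (Q + 1) * (C + 3) * u ≤ 32 * (Q + 1) * (C + 3) * u ^ 2 :=
      Nat.mul_le_mul_left _ (Nat.le_self_pow two_ne_zero u)
    refine le_trans ?_ h7
    have e : 32 * (Q + 1) * (C + 3) * u = 32 * (Q * C * u + 3 * (Q * u) + C * u + 3 * u) := by ring
    have h8 : Q ≤ Q * u := Nat.le_mul_of_pos_right _ (by omega)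
    omega

/-- If the precision dominates, printing the answer requires space. -/
theorem Solves.exists_le_head_tiny {m n g s C : ℕ} (hm : 1 ≤ m) (hmg : m < g) (hn1 : 2 ^ g ≤ n)
    (hn2 : n < 2 ^ (g + 1)) (hC : 32 ≤ C) (hg : 48 ≤ g)
    (hsm : ∀ l ≤ C * g, 8 * (M.numConfigs s l + 2) ≤ 2 ^ (g / 24))
    (h : M.Solves (tinyProblem m n (n - 2))) :
    ∃ t, s ≤ (M.run (tinyProblem m n (n - 2)).encode t).head := by
  by_contra! hhead
  have hgg : g < 2 ^ g := Nat.lt_two_pow_self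
  have h1 := h.le_numConfigs hm (by omega) hhead
  have h2 := hsm _ ((length_encode_tinyProblem_le hmg.le hn2 (by omega)).trans
    (Nat.mul_le_mul_right _ hC))
  have h3 : 2 * 2 ^ (g / 24) ≤ 2 ^ (g - 1) := by
    rw [← pow_succ']
    exact Nat.pow_le_pow_right (by norm_num) (by omega)
  have h4 : g - 1 < 2 ^ (g - 1) := Nat.lt_two_pow_self
  have h5 : 2 ^ g = 2 * 2 ^ (g - 1) := by
    rw [← pow_succ', Nat.sub_add_cancel (by omega)]
  omega

/-- If the noise dominates, the diagonal problem requires space. -/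
theorem Solves.exists_le_head_diag {m n s : ℕ} (hm : 24 ≤ m) (hn : 3 ≤ n)
    (hn2 : n < 2 ^ (m + 1))
    (hfit : (∀ l ≤ 9 * (40 + M.simExpr.encode.length) * m,
        8 * (M.numConfigs s l + 2) ≤ 2 ^ (m / 24)) ∧ M.base ^ s ≤ 2 ^ (m / 24) ∧
      Nat.card M.State + 9 * (40 + M.simExpr.encode.length) * m + 2 ≤ 2 ^ (m / 24))
    (h : M.Solves (M.diagProblem m n)) :
    ∃ t, s ≤ (M.run (M.diagProblem m n).encode t).head := by
  by_contra! hhead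
  have hlen := M.length_encode_diagProblem_le hm hn2
  exact not_solves_diagProblem hm hn hhead ⟨by omega, by omega, hfit.2.1⟩ (hfit.1 _ hlen) h

end Machine

theorem exists_mul_sq_le_two_pow (D : ℕ) : ∃ k, ∀ u, k ≤ u → D * u ^ 2 ≤ 2 ^ (u / 48) := by
  have ht := tendsto_pow_const_div_const_pow_of_one_lt 2 (by norm_num : (1 : ℝ) < 2)
  have hc : (0 : ℝ) < 1 / (D * 96 ^ 2 + 1) := by positivity
  obtain ⟨k, hk⟩ := Filter.eventually_atTop.1 (ht.eventually (gt_mem_nhds hc))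
  refine ⟨48 * (k + 1), fun u hu => ?_⟩
  obtain ⟨v, hv⟩ : ∃ v, v = u / 48 := ⟨_, rfl⟩
  have hv1 : u ≤ 96 * v := by omega
  have h := hk v (by omega)
  rw [div_lt_div_iff₀ (by positivity) (by positivity)] at h
  have h' : D * (96 * v) ^ 2 ≤ 2 ^ v := by
    have : ((D * (96 * v) ^ 2 : ℕ) : ℝ) ≤ ((2 ^ v : ℕ) : ℝ) := by
      push_cast
      have : (0 : ℝ) ≤ (v : ℝ) ^ 2 := by positivity
      nlinarith
    exact_mod_cast this
  rw [← hv]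
  exact (Nat.mul_le_mul_left _ (Nat.pow_le_pow_left hv1 2)).trans h'

/-- With `g = ⌊log₂ n⌋`, the quantity `log (1 / ε) + log (log (1 / δ))` is comparable to `m + g`. -/
theorem log_add_log_log_bounds {m n g : ℕ} (hg : 2 ≤ g) (h1 : 2 ^ g ≤ n) (h2 : n < 2 ^ (g + 1)) :
    ((m : ℝ) + g) / 4 ≤ Real.log (1 / (1 / 2) ^ m) + Real.log (Real.log (1 / (1 / 2) ^ n)) ∧
      Real.log (1 / (1 / 2) ^ m) + Real.log (Real.log (1 / (1 / 2) ^ n)) ≤ 2 * (m + g) := by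
  have hl1 := Real.log_two_gt_d9
  have hl2 := Real.log_two_lt_d9
  have e : ∀ j : ℕ, Real.log (1 / (1 / 2) ^ j) = j * Real.log 2 := by
    intro j
    rw [one_div, ← inv_pow, one_div, inv_inv, Real.log_pow]
  rw [e, e]
  have hgR : (2 : ℝ) ≤ g := by exact_mod_cast hg
  have h1R : (2 : ℝ) ^ g ≤ n := by exact_mod_cast h1
  have h2R : (n : ℝ) ≤ 2 ^ (g + 1) := by exact_mod_cast h2.le
  have hp : (0 : ℝ) < 2 ^ g := by positivity
  have hm : (0 : ℝ) ≤ m := Nat.cast_nonneg m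
  have up : Real.log (n * Real.log 2) ≤ (g + 1) * Real.log 2 := by
    have := Real.log_le_log (by nlinarith) (show n * Real.log 2 ≤ 2 ^ (g + 1) by nlinarith)
    rw [Real.log_pow] at this
    exact_mod_cast this
  have low : (g - 1) * Real.log 2 ≤ Real.log (n * Real.log 2) := by
    have := Real.log_le_log (by positivity) (show (2 : ℝ) ^ g / 2 ≤ n * Real.log 2 by nlinarith)
    rw [Real.log_div (by positivity) (by norm_num), Real.log_pow] at this
    linarith
  constructor <;> nlinarith

/-- A length that is linear in `max m g` is linear in `log (1 / ε) + log (log (1 / δ))`. -/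
theorem le_mul_of_le_max {m g u l C : ℕ} {X : ℝ} (hu : u = max m g) (hl : l ≤ C * u)
    (hX : ((m : ℝ) + g) / 4 ≤ X) : (l : ℝ) ≤ 4 * (C : ℕ) * X := by
  have h1 : (l : ℝ) ≤ C * u := by exact_mod_cast hl
  have h2 : (u : ℝ) ≤ m + g := by exact_mod_cast (by omega : u ≤ m + g)
  have h3 : (C : ℝ) * u ≤ C * (4 * X) := by
    gcongr
    linarith
  linarith

/-- A small multiple of `log (1 / ε) + log (log (1 / δ))` is at most `max m g / (48 * a)`. As
`max m g` is at least `48 * a`, rounding down costs no more than a factor `2`. -/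
theorem mul_le_div_of_max {m g u a : ℕ} {X : ℝ} (hu : u = max m g) (ha : 1 ≤ a)
    (hau : 48 * a ≤ u) (hX : X ≤ 2 * (m + g)) :
    1 / (384 * (a : ℝ)) * X ≤ (u / (48 * a) : ℕ) := by
  obtain ⟨s, hs⟩ : ∃ s, s = u / (48 * a) := ⟨_, rfl⟩
  rw [← hs]
  have h1 : u < (s + 1) * (48 * a) := by
    rw [hs]
    exact Nat.lt_mul_of_div_lt (Nat.lt_succ_self _) (by omega)
  have h2 : 1 ≤ s := by
    rw [hs]
    exact (Nat.one_le_div_iff (by omega)).2 hau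
  have h3 : u ≤ 96 * a * s := by nlinarith
  have h4 : (u : ℝ) ≤ 96 * a * s := by exact_mod_cast h3
  have h5 : (m : ℝ) + g ≤ 2 * u := by exact_mod_cast (by omega : m + g ≤ 2 * u)
  have haR : (0 : ℝ) < a := by exact_mod_cast ha
  rw [one_div, inv_mul_le_iff₀ (by positivity)]
  linarith

end NoisySpace

theorem mainTheorem7 (M : NoisySpace.Machine)
    (hM : ∀ P : NoisySpace.Problem, P.Valid → M.Solves P) :
    ∃ c : ℝ, 0 < c ∧ ∃ C : ℝ, ∃ k : ℕ, ∀ m n : ℕ, k ≤ m → k ≤ n →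
      ∃ P : NoisySpace.Problem, P.Valid ∧ P.m = m ∧ P.n = n ∧
        (P.encode.length : ℝ) ≤
          C * (Real.log (1 / P.eps) + Real.log (Real.log (1 / P.delta))) ∧
        M.UsesSpace P.encode
          (c * (Real.log (1 / P.eps) + Real.log (Real.log (1 / P.delta)))) := by
  have ha1 : 1 ≤ M.symBits := Nat.le_add_left 1 _
  obtain ⟨k, hk⟩ := NoisySpace.exists_mul_sq_le_two_pow
    (32 * (Nat.card M.State + 1) * (9 * (40 + M.simExpr.encode.length) + 3))
  refine ⟨1 / (384 * M.symBits), by positivity, 4 * (9 * (40 + M.simExpr.encode.length) : ℕ),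
    max k (48 * M.symBits), fun m n hm hn => ?_⟩
  rw [max_le_iff] at hm hn
  obtain ⟨g, hg⟩ : ∃ g, g = Nat.log 2 n := ⟨_, rfl⟩
  have hn1 : 2 ^ g ≤ n := hg ▸ Nat.pow_log_le_self 2 (by omega)
  have hn2 : n < 2 ^ (g + 1) := hg ▸ Nat.lt_pow_succ_log_self (by norm_num) n
  have hg2 : 2 ≤ g := hg ▸ Nat.le_log_of_pow_le (by norm_num) (by omega)
  obtain ⟨u, hu⟩ : ∃ u, u = max m g := ⟨_, rfl⟩
  have hmu : m ≤ u := hu ▸ le_max_left _ _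
  have hfit := NoisySpace.Machine.configs_fit (M := M) (s := u / (48 * M.symBits)) rfl (by omega)
    (hk u (hm.1.trans hmu))
  -- it is enough to exceed a space bound that is a fixed fraction of the larger of `m`, `log n`
  suffices ∃ P : NoisySpace.Problem, P.Valid ∧ P.m = m ∧ P.n = n ∧
      P.encode.length ≤ 9 * (40 + M.simExpr.encode.length) * u ∧
      ∃ t, u / (48 * M.symBits) ≤ (M.run P.encode t).head by
    obtain ⟨P, hP, rfl, rfl, hlen, t, ht⟩ := this
    have hX := NoisySpace.log_add_log_log_bounds (m := P.m) hg2 hn1 hn2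
    rw [← NoisySpace.Problem.eps, ← NoisySpace.Problem.delta] at hX
    refine ⟨P, hP, rfl, rfl, NoisySpace.le_mul_of_le_max hu hlen hX.1, t, ?_⟩
    refine (NoisySpace.mul_le_div_of_max hu ha1 (hm.2.trans hmu) hX.2).trans ?_
    exact (Nat.cast_le.2 ht).trans (le_add_of_nonneg_right zero_le_one)
  rcases lt_or_ge m g with hmg | hmg
  · obtain rfl : u = g := by omega
    have hvalid : (NoisySpace.tinyProblem m n (n - 2)).Valid :=
      ⟨le_rfl, Nat.zero_le _, Nat.one_le_two_pow⟩
    exact ⟨_, hvalid, rfl, rfl,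
      (NoisySpace.Machine.length_encode_tinyProblem_le hmu hn2 (by omega)).trans
        (Nat.mul_le_mul_right _ (by omega)),
      (hM _ hvalid).exists_le_head_tiny (by omega) hmg hn1 hn2 (by omega) (by omega) hfit.1⟩
  · obtain rfl : u = m := by omega
    have hvalid : (M.diagProblem u n).Valid :=
      ⟨show 5 * (u / 24) + 1 ≤ u by omega, show 1 ≤ 2 by norm_num, show 2 ≤ 2 ^ 1 by norm_num⟩
    have hn3 : n < 2 ^ (u + 1) := hn2.trans_le (Nat.pow_le_pow_right (by norm_num) (by omega))
    exact ⟨_, hvalid, rfl, rfl,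
      NoisySpace.Machine.length_encode_diagProblem_le (by omega) hn3,
      (hM _ hvalid).exists_le_head_diag (by omega) (by omega) hn3 hfit⟩
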